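/- Let $p$ be a prime. For a profinite group $G$ and a discrete $G$-module $M$, $H^i(G,M)$ denotes continuous cohomology. **Manageable groups.** Let $\Gamma$ be a profinite group and let $\mathbb{Z}_p(1)$ be the module $\mathbb{Z}_p$ with $\Gamma$ acting via a continuous character $\chi\colon\Gamma\to\mathbb{Z}_p^\times$. Assume that $\Gamma$ is *$p$-manageable* with respect to $\mathbb{Z}_p(1)$, that is: 1. $\Gamma$ has a pro-$p$-Sylow subgroup $\Gamma_p$ such that $\dim_{\mathbb{F}_p}H^2(\Gamma_p,\mathbb{F}_p)=1$ and the cup product $H^1(\Gamma_p,\mathbb{F}_p)\times H^1(\Gamma_p,\mathbb{F}_p)\to H^2(\Gamma_p,\mathbb{F}_p)$ has trivial left kernel; 2. for a pro-$p$-Sylow subgroup $\Gamma_p\subset\Gamma$, the reduction map $H^1(\Gamma_p,(\mathbb{Z}/p^s)(1))\to H^1(\Gamma_p,\mathbb{F}_p(1))$ is onto for every $s\ge 2$. **Flags.** Let $r,d\ge 1$. A *complete $(\Gamma,r)$-flag* $\nabla_{d,r}$ of rank $d$ is a free $\mathbb{Z}/p^r$-module $V_{d,r}$ of rank $d$ with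 a $\mathbb{Z}/p^r$-linear action of $\Gamma$ that factors through the quotient by an open normal subgroup, together with $\Gamma$-stable submodules $0=V_{0,r}\subset V_{1,r}\subset\dots\subset V_{d,r}$, where $V_{i,r}$ is free of rank $i$. Put $L_{i,r}=V_{i,r}/V_{i-1,r}$. For $1\le s\le r$, write $V_{i,s}=V_{i,r}\otimes\mathbb{Z}/p^s$ and $L_{i,s}=L_{i,r}\otimes\mathbb{Z}/p^s$. For a $\mathbb{Z}/p^s$-linear $\Gamma$-module $M$ and $n\in\mathbb{Z}$, $M(n)$ is $M$ with its action multiplied by $\chi^n \bmod p^s$. For a one-dimensional representation $L$ of $\Gamma$ over $\mathbb{F}_p$, given by a character $\chi_L$, $\mathbf{W}_r(L)$ is $\mathbb{Z}/p^r$ with $\Gamma$ acting via the Teichmüller lift $\Gamma\xrightarrow{\chi_L}\mathbb{F}_p^\times\to(\mathbb{Z}/p^r)^\times$. The flag $\nabla_{d,r}$ is *wound* if for all $1\le i\le d-1$ the extension of $\mathbb{F}_p[\Gamma]$-modules $$0\to L_{i,1}\to V_{i+1,1}/V_{i-1,1}\to L_{i+1,1}\to 0$$ does not split. A wound flag is a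 *wound Kummer flag* if moreover there is $N\in\mathbb{Z}$ such that, for all $i=1,\dots,d$, $$L_{i,r}\simeq\mathbf{W}_r(L_{i,1}(i))(N-i)$$ as $\Gamma$-modules over $\mathbb{Z}/p^r$. **Claim.** Let $\nabla_{d,r}$ be a wound Kummer $(\Gamma,r)$-flag of rank $d$. Then it admits a lift to a wound Kummer $(\Gamma,r+1)$-flag: there is a wound Kummer $(\Gamma,r+1)$-flag of rank $d$ whose reduction modulo $p^r$ is isomorphic, as a $(\Gamma,r)$-flag, to $\nabla_{d,r}$. -/

import Mathlib

universe u v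

/-! ## Continuous cohomology in degrees one and two

For a topological group `G` acting linearly on a discrete `R`-module `M`, we use the inhomogeneous
continuous cochains.  A cochain with values in a discrete module is continuous if and only if it is
locally constant. -/

namespace ContCoh

variable {R : Type*} [CommRing R] {G : Type*} [Group G] [TopologicalSpace G]
  {M : Type*} [AddCommGroup M] [Module R M]

/-- Continuous `1`-cocycles `f : G → M`, i.e. `f (g h) = f g + g • f h`. -/
def Z1 (ρ : Representation R G M) : Submodule R (G → M) where
  carrier := {f | IsLocallyConstant f ∧ ∀ g h, f (g * h) = f g + ρ g (f h)}
  zero_mem' := ⟨IsLocallyConstant.const 0, fun g h => by simp⟩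
  add_mem' := by
    rintro a b ⟨ha, ha'⟩ ⟨hb, hb'⟩
    refine ⟨ha.add hb, fun g h => ?_⟩
    simp only [Pi.add_apply, ha', hb', map_add]
    abel
  smul_mem' := by
    rintro c a ⟨ha, ha'⟩
    refine ⟨ha.comp (fun x => c • x), fun g h => ?_⟩
    simp only [Pi.smul_apply, ha', map_smul, smul_add]

/-- The differential `M → (G → M)`, `m ↦ (g ↦ g • m - m)`. -/
def d0 (ρ : Representation R G M) : M →ₗ[R] (G → M) where
  toFun m := fun g => ρ g m - m
  map_add' a b := by
    funext g
    simp only [map_add, Pi.add_apply]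
    abel
  map_smul' c a := by
    funext g
    simp only [map_smul, Pi.smul_apply, RingHom.id_apply, smul_sub]

/-- First continuous cohomology `H¹(G, M)`. -/
abbrev H1 (ρ : Representation R G M) : Type _ :=
  ↥(Z1 ρ) ⧸ (LinearMap.range (d0 ρ)).submoduleOf (Z1 ρ)

/-- Continuous `1`-cochains. -/
def C1 (R G M : Type*) [CommRing R] [TopologicalSpace G] [AddCommGroup M] [Module R M] :
    Submodule R (G → M) where
  carrier := {f | IsLocallyConstant f}
  zero_mem' := IsLocallyConstant.const 0
  add_mem' ha hb := IsLocallyConstant.add ha hb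
  smul_mem' c _ ha := IsLocallyConstant.comp ha (fun x => c • x)

/-- Continuous `2`-cocycles `f : G × G → M`,
i.e. `g • f (h, k) - f (g h, k) + f (g, h k) - f (g, h) = 0`. -/
def Z2 (ρ : Representation R G M) : Submodule R (G × G → M) where
  carrier := {f | IsLocallyConstant f ∧
    ∀ g h k, ρ g (f (h, k)) + f (g, h * k) = f (g * h, k) + f (g, h)}
  zero_mem' := ⟨IsLocallyConstant.const 0, fun g h k => by simp⟩
  add_mem' := by
    rintro a b ⟨ha, ha'⟩ ⟨hb, hb'⟩
    refine ⟨ha.add hb, fun g h k => ?_⟩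
    simp only [Pi.add_apply, map_add]
    have h1 := ha' g h k
    have h2 := hb' g h k
    calc _ = (ρ g (a (h, k)) + a (g, h * k)) + (ρ g (b (h, k)) + b (g, h * k)) := by abel
      _ = _ := by rw [h1, h2]; abel
  smul_mem' := by
    rintro c a ⟨ha, ha'⟩
    refine ⟨ha.comp (fun x => c • x), fun g h k => ?_⟩
    simp only [Pi.smul_apply, map_smul, ← smul_add, ha']

/-- The differential on `1`-cochains, `(dφ)(g, h) = g • φ h - φ (g h) + φ g`. -/
def d1 (ρ : Representation R G M) : (G → M) →ₗ[R] (G × G → M) where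
  toFun φ := fun x => ρ x.1 (φ x.2) - φ (x.1 * x.2) + φ x.1
  map_add' a b := by
    funext g
    simp only [map_add, Pi.add_apply]
    abel
  map_smul' c a := by
    funext g
    simp only [map_smul, Pi.smul_apply, RingHom.id_apply, smul_sub, smul_add]

/-- Second continuous cohomology `H²(G, M)`: continuous `2`-cocycles modulo the coboundaries of
continuous `1`-cochains. -/
abbrev H2 (ρ : Representation R G M) : Type _ :=
  ↥(Z2 ρ) ⧸ ((C1 R G M).map (d1 ρ)).submoduleOf (Z2 ρ)

section Functoriality

variable {S : Type*} [CommRing S] {N : Type*} [AddCommGroup N] [Module S N]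

/-- The map on continuous `1`-cocycles induced by a `G`-equivariant additive map of
coefficients. -/
def Z1map (ρ : Representation R G M) (σ : Representation S G N) (f : M →+ N)
    (hf : ∀ g m, f (ρ g m) = σ g (f m)) : ↥(Z1 ρ) →+ ↥(Z1 σ) where
  toFun a := ⟨fun g => f (a.1 g), a.2.1.comp f, fun g h => by
    change f (a.1 (g * h)) = f (a.1 g) + σ g (f (a.1 h))
    rw [a.2.2 g h, map_add, hf]⟩
  map_zero' := by
    ext g
    simp
  map_add' a b := by
    ext g
    simp

/-- The map `H¹(G, M) → H¹(G, N)` induced by a `G`-equivariant additive map `M → N`. -/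
def H1map (ρ : Representation R G M) (σ : Representation S G N) (f : M →+ N)
    (hf : ∀ g m, f (ρ g m) = σ g (f m)) : H1 ρ →+ H1 σ :=
  QuotientAddGroup.map _ _ (Z1map ρ σ f hf) (by
    rintro a ⟨m, hm⟩
    refine ⟨f m, ?_⟩
    funext g
    have h := congrFun hm g
    simp only [d0, LinearMap.coe_mk, AddHom.coe_mk, Submodule.coe_subtype] at h
    simp only [d0, LinearMap.coe_mk, AddHom.coe_mk, Submodule.coe_subtype, Z1map,
      AddMonoidHom.coe_mk, ZeroHom.coe_mk, ← h, map_sub, hf])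

end Functoriality

section Cup

variable (k : Type*) [CommRing k] (G)

/-- The cup product on continuous `1`-cocycles with trivial coefficients `k`,
`(a ∪ b)(g, h) = a g * b h`. -/
def cupZ : ↥(Z1 (Representation.trivial k G k)) →ₗ[k] ↥(Z1 (Representation.trivial k G k)) →ₗ[k]
    ↥(Z2 (Representation.trivial k G k)) :=
  LinearMap.mk₂ k
    (fun a b => ⟨fun x => a.1 x.1 * b.1 x.2,
      (a.2.1.comp_continuous continuous_fst).mul (b.2.1.comp_continuous continuous_snd),
      fun g h l => by
        have h1 := a.2.2 g h
        have h2 := b.2.2 h l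
        simp only [Representation.trivial_apply] at h1 h2 ⊢
        rw [h1, h2]
        ring⟩)
    (fun a a' b => by ext x; simp [add_mul])
    (fun c a b => by ext x; simp [mul_assoc])
    (fun a b b' => by ext x; simp [mul_add])
    (fun c a b => by ext x; simp [mul_left_comm])

theorem eq_zero_of_mem_B1_trivial (a : ↥(Z1 (Representation.trivial k G k)))
    (ha : a ∈ (LinearMap.range (d0 (Representation.trivial k G k))).submoduleOf
      (Z1 (Representation.trivial k G k))) : a = 0 := by
  obtain ⟨m, hm⟩ := ha
  ext g
  have h := congrFun hm g
  simpa [d0] using h.symm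

/-- The cup product `H¹(G, k) × H¹(G, k) → H²(G, k)` with trivial coefficients. -/
def cup : H1 (Representation.trivial k G k) →ₗ[k] H1 (Representation.trivial k G k) →ₗ[k]
    H2 (Representation.trivial k G k) :=
  (Submodule.liftQ _
    (Submodule.liftQ _ ((cupZ G k).compr₂ (Submodule.mkQ _)) (fun a ha => by
      rw [eq_zero_of_mem_B1_trivial G k a ha]
      exact Submodule.zero_mem _)).flip (fun a ha => by
      rw [eq_zero_of_mem_B1_trivial G k a ha]
      exact Submodule.zero_mem _)).flip

theorem cup_mk (a b : ↥(Z1 (Representation.trivial k G k))) :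
    cup G k (Submodule.Quotient.mk a) (Submodule.Quotient.mk b) =
      Submodule.Quotient.mk (cupZ G k a b) := rfl

end Cup

end ContCoh

/-! ## Pro-`p` Sylow subgroups and `p`-manageable profinite groups -/

/-- A profinite group is pro-`p` if its quotients by open normal subgroups are `p`-groups. -/
def IsProP (p : ℕ) (G : Type*) [Group G] [TopologicalSpace G] : Prop :=
  ∀ U : Subgroup G, ∀ _ : U.Normal, IsOpen (U : Set G) → IsPGroup p (G ⧸ U)

/-- `P` is a pro-`p`-Sylow subgroup of the profinite group `G`: it is a closed pro-`p`-subgroup of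
index prime to `p`, i.e. every open subgroup containing `P` has index prime to `p`. -/
structure IsProPSylow (p : ℕ) {G : Type*} [Group G] [TopologicalSpace G] (P : Subgroup G) :
    Prop where
  isClosed : IsClosed (P : Set G)
  isProP : IsProP p P
  coprime_index : ∀ U : Subgroup G, IsOpen (U : Set G) → P ≤ U → Nat.Coprime p U.index

/-- `G` is a (not necessarily finitely generated) Demuškin pro-`p`-group. -/
structure IsDemuskin (p : ℕ) (G : Type*) [Group G] [TopologicalSpace G] : Prop where
  isProP : IsProP p G
  finrank_H2 : Module.finrank (ZMod p)
    (ContCoh.H2 (Representation.trivial (ZMod p) G (ZMod p))) = 1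
  left_kernel : LinearMap.ker (ContCoh.cup G (ZMod p)) = ⊥

/-- `G` is `p`-Demuškin: it has a Demuškin pro-`p`-Sylow subgroup. -/
def IsPDemuskin (p : ℕ) (G : Type*) [Group G] [TopologicalSpace G] : Prop :=
  ∃ P : Subgroup G, IsProPSylow p P ∧ IsDemuskin p P

section Twists

variable {G : Type*} [Group G]

/-- The twist of a representation `ρ` by the `k`-th power of a character `ψ`. -/
def twist {R : Type*} [CommRing R] {M : Type*} [AddCommGroup M] [Module R M]
    (ψ : G →* Rˣ) (k : ℤ) (ρ : Representation R G M) : Representation R G M where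
  toFun g := ((ψ g ^ k : Rˣ) : R) • ρ g
  map_one' := by simp
  map_mul' g h := by
    ext m
    simp only [map_mul, mul_zpow, Units.val_mul, LinearMap.smul_apply, Module.End.mul_apply,
      map_smul, smul_smul]
    rw [mul_comm]

variable [TopologicalSpace G] {p : ℕ} [Fact p.Prime]

/-- The reduction modulo `p ^ r` of a `p`-adic character. -/
noncomputable def charModPow (χ : G →ₜ* ℤ_[p]ˣ) (r : ℕ) : G →* (ZMod (p ^ r))ˣ :=
  (Units.map (PadicInt.toZModPow r : ℤ_[p] →+* ZMod (p ^ r)).toMonoidHom).comp χ.toMonoidHom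

/-- The reduction modulo `p` of a `p`-adic character. -/
noncomputable def charMod (χ : G →ₜ* ℤ_[p]ˣ) : G →* (ZMod p)ˣ :=
  (Units.map (PadicInt.toZMod : ℤ_[p] →+* ZMod p).toMonoidHom).comp χ.toMonoidHom

/-- The `(Γ, r)`-module `(ℤ/p^r)(1)`, where `ℤ_p(1)` is `ℤ_p` with `Γ` acting via `χ`. -/
noncomputable def tateModPow (χ : G →ₜ* ℤ_[p]ˣ) (r : ℕ) :
    Representation (ZMod (p ^ r)) G (ZMod (p ^ r)) :=
  twist (charModPow χ r) 1 (Representation.trivial _ G _)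

/-- The `(Γ, 1)`-module `𝔽_p(1)`. -/
noncomputable def tateMod (χ : G →ₜ* ℤ_[p]ˣ) : Representation (ZMod p) G (ZMod p) :=
  twist (charMod χ) 1 (Representation.trivial _ G _)

theorem castHom_toZModPow {r : ℕ} (hr : r ≠ 0) (x : ℤ_[p]) :
    ZMod.castHom (dvd_pow_self p hr) (ZMod p) (PadicInt.toZModPow r x) = PadicInt.toZMod x := by
  have : (ZMod.castHom (dvd_pow_self p hr) (ZMod p)).comp (PadicInt.toZModPow r)
      = (PadicInt.toZMod : ℤ_[p] →+* ZMod p) := by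
    apply ZMod.ringHom_eq_of_ker_eq
    rw [PadicInt.ker_toZMod]
    apply IsLocalRing.eq_maximalIdeal
    exact RingHom.ker_isMaximal_of_surjective _ (ZMod.ringHom_surjective _)
  exact congrArg (fun f : ℤ_[p] →+* ZMod p => f x) this

/-- The reduction map `(ℤ/p^r)(1) → 𝔽_p(1)` is `Γ`-equivariant. -/
theorem tate_reduction_equivariant (χ : G →ₜ* ℤ_[p]ˣ) {r : ℕ} (hr : r ≠ 0) (g : G)
    (m : ZMod (p ^ r)) :
    (ZMod.castHom (dvd_pow_self p hr) (ZMod p)).toAddMonoidHom (tateModPow χ r g m) =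
      tateMod χ g ((ZMod.castHom (dvd_pow_self p hr) (ZMod p)).toAddMonoidHom m) := by
  have h := castHom_toZModPow (p := p) hr (χ g : ℤ_[p])
  simp only [tateModPow, tateMod, twist, MonoidHom.coe_mk, OneHom.coe_mk, zpow_one,
    LinearMap.smul_apply, Representation.trivial_apply, smul_eq_mul]
  change ZMod.castHom (dvd_pow_self p hr) (ZMod p) (PadicInt.toZModPow r (χ g : ℤ_[p]) * m) =
    PadicInt.toZMod (χ g : ℤ_[p]) * ZMod.castHom (dvd_pow_self p hr) (ZMod p) m
  rw [map_mul, h]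

/-- The property wH90 of `(G, ℤ_p(1))`: for a pro-`p`-Sylow `P ⊆ G`, the reduction map
`H¹(P, (ℤ/p^r)(1)) → H¹(P, 𝔽_p(1))` is onto for every `r ≥ 2`. -/
def WH90 (χ : G →ₜ* ℤ_[p]ˣ) : Prop :=
  ∃ P : Subgroup G, IsProPSylow p P ∧ ∀ (r : ℕ) (hr : 2 ≤ r),
    Function.Surjective (ContCoh.H1map
      ((tateModPow χ r).comp P.subtype) ((tateMod χ).comp P.subtype)
      (ZMod.castHom (dvd_pow_self p (by omega : r ≠ 0)) (ZMod p)).toAddMonoidHom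
      (fun g m => tate_reduction_equivariant χ (by omega) (g : G) m))

/-- `G` is `p`-manageable with respect to `ℤ_p(1)`, the module `ℤ_p` with `G` acting via `χ`. -/
structure IsManageable (χ : G →ₜ* ℤ_[p]ˣ) : Prop where
  demuskin : IsPDemuskin p G
  wh90 : WH90 χ

/-- The Teichmüller section `𝔽_p → ℤ/p^r` (as a multiplicative map), obtained from the Teichmüller
map `𝔽_p → W(𝔽_p)` and the projection `W(𝔽_p) → W_r(𝔽_p) = ℤ/p^r`. -/
noncomputable def teichmullerMod (p : ℕ) [Fact p.Prime] (r : ℕ) : ZMod p →* ZMod (p ^ r) :=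
  (WittVector.toZModPow p r : WittVector p (ZMod p) →+* ZMod (p ^ r)).toMonoidHom.comp
    (WittVector.teichmuller p)

/-- The character of a representation on a free module of rank one.  An endomorphism of such a
module is a scalar, equal to its determinant. -/
noncomputable def lineChar {R : Type*} [CommRing R] {L : Type*} [AddCommGroup L] [Module R L]
    (ρ : Representation R G L) : G →* Rˣ :=
  ((LinearMap.det : (L →ₗ[R] L) →* R).comp ρ).toHomUnits

/-- The `r`-th Teichmüller lift `W_r(L)` of an invertible `(Γ, 1)`-bundle `L`: the module `ℤ/p^r`
on which `Γ` acts via the Teichmüller lift of the character of `L`. -/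
noncomputable def teichmullerLift (r : ℕ) {L : Type*} [AddCommGroup L] [Module (ZMod p) L]
    (ρ : Representation (ZMod p) G L) : Representation (ZMod (p ^ r)) G (ZMod (p ^ r)) :=
  twist ((Units.map (teichmullerMod p r)).comp (lineChar ρ)) 1 (Representation.trivial _ G _)

end Twists

/-! ## Flags -/

/-- A `ℤ/n`-linear representation of `Γ` with an increasing filtration by subrepresentations.
Being a complete flag of bundles is the predicate `FiltRep.IsCompleteFlag`. -/
structure FiltRep (n : ℕ) (Γ : Type v) [Group Γ] where
  /-- the underlying module -/
  carrier : Type u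
  [addCommGroup : AddCommGroup carrier]
  [module : Module (ZMod n) carrier]
  /-- the action of `Γ` -/
  rep : Representation (ZMod n) Γ carrier
  /-- the filtration `V_0 ⊆ V_1 ⊆ ⋯` -/
  fil : ℕ → Submodule (ZMod n) carrier
  fil_mono : Monotone fil
  fil_stable : ∀ i g, fil i ≤ (fil i).comap (rep g)

namespace FiltRep

attribute [instance] FiltRep.addCommGroup FiltRep.module

variable {n : ℕ} {Γ : Type v} [Group Γ]

/-- `F` is a complete `d`-dimensional flag `0 = V_0 ⊆ V_1 ⊆ ⋯ ⊆ V_d` of `Γ`-bundles over `ℤ/n`: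
`V_d` is the whole module, `V_i` is free of rank `i`, and `Γ` acts through a quotient by an open
normal subgroup. -/
structure IsCompleteFlag [TopologicalSpace Γ] (F : FiltRep.{u} n Γ) (d : ℕ) : Prop where
  continuous_action : ∃ U : Subgroup Γ, U.Normal ∧ IsOpen (U : Set Γ) ∧ ∀ g ∈ U, F.rep g = 1
  finite : Module.Finite (ZMod n) F.carrier
  fil_zero : F.fil 0 = ⊥
  fil_top : F.fil d = ⊤
  free : ∀ i ≤ d, Module.Free (ZMod n) (F.fil i)
  finrank : ∀ i ≤ d, Module.finrank (ZMod n) (F.fil i) = i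

/-- The subquotient `V_{j/i} = V_j / V_i` (for `i ≤ j`). -/
abbrev quo (F : FiltRep.{u} n Γ) (i j : ℕ) : Type u :=
  ↥(F.fil j) ⧸ (F.fil i).submoduleOf (F.fil j)

/-- The action of `Γ` on `V_j / V_i`. -/
def quoRep (F : FiltRep.{u} n Γ) (i j : ℕ) : Representation (ZMod n) Γ (F.quo i j) :=
  (F.rep.subrepresentation (F.fil j) (F.fil_stable j)).quotient
    ((F.fil i).submoduleOf (F.fil j)) (fun g _ hx => F.fil_stable i g hx)

/-- The natural surjection `V_k / V_i → V_k / V_j`, for `i ≤ j`. -/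
def quoProj (F : FiltRep.{u} n Γ) {i j : ℕ} (h : i ≤ j) (k : ℕ) :
    F.quo i k →ₗ[ZMod n] F.quo j k :=
  Submodule.factor (Submodule.comap_mono (F.fil_mono h))

/-- For `i ≤ j ≤ k`, the extension of `Γ`-modules `0 → V_j/V_i → V_k/V_i → V_k/V_j → 0` splits:
its surjection has a `Γ`-equivariant section. -/
def ExtSplits (F : FiltRep.{u} n Γ) {i j : ℕ} (h : i ≤ j) (k : ℕ) : Prop :=
  ∃ s : (F.quoRep j k).IntertwiningMap (F.quoRep i k),
    F.quoProj h k ∘ₗ s.toLinearMap = LinearMap.id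

/-- The underlying group of the reduction `V ⊗ ℤ/m = V / m V`. -/
def Red (F : FiltRep.{u} n Γ) (m : ℕ) : Type u :=
  F.carrier ⧸ LinearMap.range (m • (LinearMap.id : F.carrier →ₗ[ZMod n] F.carrier))

instance (F : FiltRep.{u} n Γ) (m : ℕ) : AddCommGroup (F.Red m) :=
  inferInstanceAs (AddCommGroup
    (F.carrier ⧸ LinearMap.range (m • (LinearMap.id : F.carrier →ₗ[ZMod n] F.carrier))))

/-- The quotient map `V → V / m V`. -/
def redMap (F : FiltRep.{u} n Γ) (m : ℕ) : F.carrier →+ F.Red m :=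
  (LinearMap.range (m • (LinearMap.id : F.carrier →ₗ[ZMod n] F.carrier))).mkQ.toAddMonoidHom

theorem redMap_surjective (F : FiltRep.{u} n Γ) (m : ℕ) : Function.Surjective (F.redMap m) :=
  Submodule.mkQ_surjective _

theorem redMap_smul (F : FiltRep.{u} n Γ) (m : ℕ) (x : F.carrier) : F.redMap m (m • x) = 0 :=
  (Submodule.Quotient.mk_eq_zero _).2 ⟨x, by simp⟩

instance (F : FiltRep.{u} n Γ) (m : ℕ) : Module (ZMod m) (F.Red m) :=
  AddCommGroup.zmodModule (fun x => by
    obtain ⟨y, rfl⟩ := F.redMap_surjective m x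
    rw [← map_nsmul, redMap_smul])

/-- The endomorphism of `V / m V` induced by the action of `g`. -/
def redEnd (F : FiltRep.{u} n Γ) (m : ℕ) (g : Γ) : F.Red m →ₗ[ZMod m] F.Red m :=
  AddMonoidHom.toZModLinearMap m (M := F.Red m) (M₁ := F.Red m)
    (Submodule.mapQ (LinearMap.range (m • (LinearMap.id : F.carrier →ₗ[ZMod n] F.carrier)))
      (LinearMap.range (m • (LinearMap.id : F.carrier →ₗ[ZMod n] F.carrier))) (F.rep g) (by
        rintro _ ⟨x, rfl⟩
        exact ⟨F.rep g x, by simp⟩)).toAddMonoidHom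

theorem redEnd_redMap (F : FiltRep.{u} n Γ) (m : ℕ) (g : Γ) (x : F.carrier) :
    F.redEnd m g (F.redMap m x) = F.redMap m (F.rep g x) := rfl

/-- The reduction modulo `m` of a filtered representation: the underlying module is
`V ⊗ ℤ/m = V / m V`, filtered by the images of the `V_i`.  (For a complete flag, `V_i` is a direct
summand of `V`, so that this image is `V_i ⊗ ℤ/m`.) -/
def reduce (F : FiltRep.{u} n Γ) (m : ℕ) : FiltRep.{u} m Γ where
  carrier := F.Red m
  rep :=
    { toFun := F.redEnd m
      map_one' := by
        ext x
        obtain ⟨y, rfl⟩ := F.redMap_surjective m x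
        simp [redEnd_redMap]
      map_mul' := fun g h => by
        ext x
        obtain ⟨y, rfl⟩ := F.redMap_surjective m x
        simp [redEnd_redMap] }
  fil i := AddSubgroup.toZModSubmodule m ((F.fil i).toAddSubgroup.map (F.redMap m))
  fil_mono i j h := by
    rintro _ ⟨x, hx, rfl⟩
    exact ⟨x, F.fil_mono h hx, rfl⟩
  fil_stable i g := by
    rintro _ ⟨x, hx, rfl⟩
    exact ⟨F.rep g x, F.fil_stable i g hx, rfl⟩

/-- `F` and `F'` are isomorphic as filtered representations. -/
def Iso (F F' : FiltRep.{u} n Γ) : Prop :=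
  ∃ e : F.rep.Equiv F'.rep, ∀ i, (F.fil i).map e.toLinearMap = F'.fil i

variable {p : ℕ}

/-- A flag over `ℤ/p^r` of dimension `d` is wound if for `1 ≤ i ≤ d - 1`, the extension
`0 → L_{i,1} → V_{i+1,1}/V_{i-1,1} → L_{i+1,1} → 0` attached to its reduction modulo `p` does not
split. -/
def IsWound (p : ℕ) (F : FiltRep.{u} n Γ) (d : ℕ) : Prop :=
  ∀ i, 1 ≤ i → i + 1 ≤ d → ¬ (F.reduce p).ExtSplits (Nat.sub_le i 1) (i + 1)

/-- `F` is a wound Kummer `(Γ, r)`-flag of dimension `d`: it is a wound complete flag, and there is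
an integer `N` such that `L_{i,r} ≃ W_r(L_{i,1}(i))(N - i)` for `i = 1, …, d`, where
`L_i = V_i / V_{i-1}`. -/
structure IsWoundKummer [TopologicalSpace Γ] [Fact p.Prime] (χ : Γ →ₜ* ℤ_[p]ˣ) {r : ℕ}
    (F : FiltRep.{u} (p ^ r) Γ) (d : ℕ) : Prop where
  complete : F.IsCompleteFlag d
  wound : F.IsWound p d
  kummer : ∃ N : ℤ, ∀ i : ℕ, 1 ≤ i → i ≤ d →
    Nonempty ((F.quoRep (i - 1) i).Equiv
      (twist (charModPow χ r) (N - i)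
        (teichmullerLift r (twist (charMod χ) i ((F.reduce p).quoRep (i - 1) i)))))

/-- `F'`, a flag over `ℤ/p^(r+1)`, is a lift of `F`: its reduction modulo `p^r` is isomorphic
to `F`. -/
def IsLift {r : ℕ} (F' : FiltRep.{u} (p ^ (r + 1)) Γ) (F : FiltRep.{u} (p ^ r) Γ) : Prop :=
  (F'.reduce (p ^ r)).Iso F

end FiltRep

/-! ## Locally constant functions on profinite groups -/

/-! In a basis adapted to the flag the action is a homomorphism to upper triangular matrices over
`ℤ/p^r`. The Kummer condition says that its `k`-th diagonal character (indexed from 0) is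
`χ^(N-(k+1))` times a Teichmüller character. Both factors have evident lifts modulo `p^(r+1)`, so
the diagonal `ψ` of the lift is fixed in advance, and only the entries above it remain to be found.

They are found by induction on the rank (`exists_triangular_hom_lift`). Once the leading block is
lifted to `A'`, the last column divided by the last diagonal character is a 1-cocycle modulo `p^r`
with values in the twisted representation `B = ψ_d⁻¹ A'`, and it must be lifted to an honest cocycle
(`exists_wound_cocycle_lift`).

Teichmüller characters are trivial on pro-`p` groups, so on a Sylow subgroup the last diagonal
character of `B` is exactly `χ`, and the bottom coordinate of the cocycle lifts by the surjectivity
hypothesis on `H¹`. The other coordinates are corrected from bottom to top. The obstruction at a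
coordinate is a class in `H²(P, 𝔽_p)`. Adding `p^r β` to the coordinate just below, with `β` a
homomorphism to `𝔽_p`, preserves what is already achieved and moves the obstruction by `a ∪ β`,
where `a` is the superdiagonal entry modulo `p`. Woundness makes `a` nonzero, and the Demuškin
property makes `a ∪ -` surjective (`exists_triangular_lift_step`).

Both arguments take place on Sylow subgroups, possibly different ones. Averaging over cosets, whose
number is prime to `p`, carries the results back to `Γ` (`exists_cocycle_of_exists_on_sylow`). -/

theorem IsLocallyConstant.exists_openNormalSubgroup {G Γ X : Type*} [Group G] [TopologicalSpace G]
    [IsTopologicalGroup G] [CompactSpace G] [Group Γ] [TopologicalSpace Γ] [IsTopologicalGroup Γ]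
    [CompactSpace Γ] [TotallyDisconnectedSpace Γ] (ι : G →* Γ) (hι : Topology.IsInducing ι)
    {f : G → X} (hf : IsLocallyConstant f) :
    ∃ V : OpenNormalSubgroup Γ, ∀ x y, (ι x)⁻¹ * ι y ∈ V → f x = f y := by
  let : TopologicalSpace X := ⊥
  have : DiscreteTopology X := ⟨rfl⟩
  -- The tube lemma around `G × {1}` in this open set gives one neighbourhood of 1 that works for
  -- all points at once.
  have hopen : IsOpen {x : G × G | f (x.1 * x.2) = f x.1} := by
    have h1 : IsLocallyConstant (fun x : G × G => (f (x.1 * x.2), f x.1)) :=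
      (hf.comp_continuous (continuous_fst.mul continuous_snd)).prodMk
        (hf.comp_continuous continuous_fst)
    exact h1 {z | z.1 = z.2}
  obtain ⟨u, w, -, hw, hu1, hw1, huw⟩ := generalized_tube_lemma (isCompact_univ (X := G))
    (isCompact_singleton (x := (1 : G))) hopen (by rintro ⟨a, b⟩ ⟨-, rfl⟩; simp)
  obtain ⟨w', hw', rfl⟩ := hι.isOpen_iff.1 hw
  obtain ⟨V, hV⟩ := ProfiniteGrp.exist_openNormalSubgroup_sub_open_nhds_of_one hw'
    (by simpa using hw1 rfl)
  refine ⟨V, fun x y hxy => ?_⟩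
  have h := @huw (x, x⁻¹ * y) ⟨hu1 trivial, hV (by simpa using hxy)⟩
  simpa using h.symm

theorem IsLocallyConstant.of_coset {Γ X : Type*} [Group Γ] [TopologicalSpace Γ]
    [IsTopologicalGroup Γ] {f : Γ → X} (V : Subgroup Γ) (hV : IsOpen (V : Set Γ))
    (h : ∀ g, ∀ v ∈ V, f (g * v) = f g) : IsLocallyConstant f := by
  rw [IsLocallyConstant.iff_exists_open]
  intro x
  refine ⟨(fun y => x⁻¹ * y) ⁻¹' V, hV.preimage (continuous_const_mul _), by simp [V.one_mem],
    fun y hy => ?_⟩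
  simpa using h x (x⁻¹ * y) hy

/-! ## Transfer from a pro-`p`-Sylow subgroup -/

section Transfer

variable {p : ℕ} {Γ : Type*} [Group Γ] [TopologicalSpace Γ] [IsTopologicalGroup Γ] [CompactSpace Γ]
  {P : Subgroup Γ}

theorem exists_nsmul_inverse {M : Type*} [AddCommGroup M] {n q : ℕ} (hq : ∀ m : M, q • m = 0)
    (hn : Nat.Coprime q n) : ∃ k : ℕ, ∀ m : M, k • (n • m) = m := by
  have hqz : ∀ m : M, (q : ℤ) • m = 0 := fun m => by rw [natCast_zsmul, hq]
  obtain ⟨k, l, hl⟩ := Nat.isCoprime_iff_coprime.2 hn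
  by_cases hq0 : q = 0
  · have : n = 1 := by simpa [hq0] using hn
    exact ⟨1, fun m => by simp [this]⟩
  -- `l` is the Bézout coefficient inverting `n` modulo `q`; it is reduced modulo `q` to obtain a
  -- natural number.
  refine ⟨(l % q).toNat, fun m => ?_⟩
  have h0 : ((l % q).toNat : ℤ) = l % q :=
    Int.toNat_of_nonneg (Int.emod_nonneg _ (by exact_mod_cast hq0))
  have h1 : l % q * n = 1 + q * (-k - l / q * n) := by
    rw [Int.emod_def]
    linear_combination hl
  rw [← natCast_zsmul, ← natCast_zsmul m, h0, ← mul_smul, h1, add_smul, mul_smul, hqz, one_smul,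
    add_zero]

/-- A continuous `1`-cocycle vanishing on a pro-`p`-Sylow subgroup, with coefficients killed by a
power of `p`, is a coboundary. -/
theorem exists_coboundary_of_eq_zero_on_sylow {R M : Type*} [CommRing R] [AddCommGroup M]
    [Module R M] {s : ℕ} (hM : ∀ m : M, p ^ s • m = 0) (hP : IsProPSylow p P)
    (ρ : Representation R Γ M) {f : Γ → M} (hf : IsLocallyConstant f)
    (hmul : ∀ g h, f (g * h) = f g + ρ g (f h)) (hfP : ∀ x ∈ P, f x = 0) :
    ∃ m, ∀ g, f g = m - ρ g m := by
  have hone : f 1 = 0 := by simpa using hmul 1 1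
  let U : Subgroup Γ :=
    { carrier := {g | f g = 0}
      one_mem' := hone
      mul_mem' := fun {a b} ha hb => by
        simp only [Set.mem_ofPred_eq] at ha hb ⊢
        rw [hmul, ha, hb]; simp
      inv_mem' := fun {a} ha => by
        simp only [Set.mem_ofPred_eq] at ha ⊢
        simpa [ha, hone] using (hmul a⁻¹ a).symm }
  have hUo : IsOpen (U : Set Γ) := hf.isOpen_fiber 0
  have : Finite (Γ ⧸ U) := Subgroup.quotient_finite_of_isOpen U hUo
  let := Fintype.ofFinite (Γ ⧸ U)
  have hcop := hP.coprime_index U hUo hfP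
  obtain ⟨k, hk⟩ := exists_nsmul_inverse hM (Nat.Coprime.pow_left s hcop)
  have hwd : ∀ a b : Γ, (a : Γ ⧸ U) = b → f a = f b := fun a b hab => by
    have : f (a⁻¹ * b) = 0 := QuotientGroup.eq.1 hab
    have h2 := hmul a (a⁻¹ * b)
    rw [this] at h2
    simpa using h2.symm
  -- The cocycle descends to `Γ ⧸ U`. Summing the cocycle identity over this finite set exhibits
  -- `U.index • f` as a coboundary, and the index is invertible on `M`.
  have hsum : ∀ g, ∑ q : Γ ⧸ U, f q.out = U.index • f g + ρ g (∑ q : Γ ⧸ U, f q.out) := fun g => by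
    calc ∑ q : Γ ⧸ U, f q.out = ∑ q : Γ ⧸ U, f (g • q).out :=
          (Equiv.sum_comp (MulAction.toPerm g) (fun q : Γ ⧸ U => f q.out)).symm
      _ = ∑ q : Γ ⧸ U, f (g * q.out) := by
          refine Finset.sum_congr rfl fun q _ => hwd _ _ ?_
          rw [QuotientGroup.out_eq', ← smul_eq_mul, ← MulAction.Quotient.smul_coe,
            QuotientGroup.out_eq']
      _ = _ := by
          simp only [hmul, Finset.sum_add_distrib, map_sum]
          simp [Subgroup.index, Nat.card_eq_fintype_card]
  refine ⟨k • ∑ q : Γ ⧸ U, f q.out, fun g => ?_⟩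
  rw [map_nsmul, ← smul_sub]
  conv_lhs => rw [← hk (f g)]
  congr 1
  rw [eq_sub_iff_add_eq, ← hsum g]

/-- Let `b` be a continuous `1`-cochain which is a cocycle modulo `K`.  If its restriction to a
pro-`p`-Sylow subgroup is congruent modulo `K` to a cocycle, then so is `b`. -/
theorem exists_cocycle_of_exists_on_sylow [T2Space Γ] [TotallyDisconnectedSpace Γ]
    {R M : Type*} [CommRing R] [AddCommGroup M]
    [Module R M] {s : ℕ} (hM : ∀ m : M, p ^ s • m = 0) (hP : IsProPSylow p P)
    (ρ : Representation R Γ M) (hρ : IsLocallyConstant ρ) (K : Submodule R M)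
    (hK : ∀ g, ∀ m ∈ K, ρ g m ∈ K) {b : Γ → M} (hb : IsLocallyConstant b)
    (hbK : ∀ g h, b g + ρ g (b h) - b (g * h) ∈ K)
    {c : P → M} (hc : IsLocallyConstant c) (hcmul : ∀ x y, c (x * y) = c x + ρ x (c y))
    (hcb : ∀ x : P, c x - b x ∈ K) :
    ∃ b' : Γ → M, IsLocallyConstant b' ∧ (∀ g h, b' (g * h) = b' g + ρ g (b' h)) ∧
      ∀ g, b' g - b g ∈ K := by
  have : CompactSpace P := isCompact_iff_compactSpace.1 hP.isClosed.isCompact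
  obtain ⟨V₁, hV₁⟩ := (hρ.prodMk hb).exists_openNormalSubgroup (MonoidHom.id Γ)
    Topology.IsInducing.id
  obtain ⟨V₂, hV₂⟩ := hc.exists_openNormalSubgroup P.subtype Topology.IsInducing.subtypeVal
  -- The functions `ρ` and `b` are constant on cosets of `V`, and `c` on cosets of `V ∩ P`. The open
  -- subgroup `U = PV` then has finite index prime to `p`.
  let V : Subgroup Γ := V₁.toSubgroup ⊓ V₂.toSubgroup
  have : V.Normal := inferInstance
  have hVo : IsOpen (V : Set Γ) := V₁.isOpen'.inter V₂.isOpen'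
  have hρV : ∀ g, ∀ v ∈ V, ρ (g * v) = ρ g := fun g v hv =>
    (congrArg Prod.fst (hV₁ g (g * v) (by
      rw [MonoidHom.id_apply, MonoidHom.id_apply, inv_mul_cancel_left]; exact hv.1))).symm
  have hbV : ∀ g, ∀ v ∈ V, b (g * v) = b g := fun g v hv =>
    (congrArg Prod.snd (hV₁ g (g * v) (by
      rw [MonoidHom.id_apply, MonoidHom.id_apply, inv_mul_cancel_left]; exact hv.1))).symm
  have hcV : ∀ x y : P, (x : Γ)⁻¹ * y ∈ V → c x = c y := fun x y h => hV₂ x y h.2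
  let U : Subgroup Γ := P ⊔ V
  have hUo : IsOpen (U : Set Γ) := Subgroup.isOpen_mono (le_sup_right : V ≤ U) hVo
  have hdec : ∀ g : Γ, ∃ x : P, (x : Γ)⁻¹ * (((g : Γ ⧸ U).out)⁻¹ * g) ∈ V := fun g => by
    have : ((g : Γ ⧸ U).out)⁻¹ * g ∈ U := by
      rw [← QuotientGroup.eq, QuotientGroup.out_eq']
    obtain ⟨x, hx, v, hv, hxv⟩ := Subgroup.mem_sup_of_normal_right.1 this
    exact ⟨⟨x, hx⟩, by rw [← hxv]; simpa using hv⟩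
  choose x hx using hdec
  -- Writing `g = out · x · v` with `x ∈ P` and `v ∈ V`, the value at `g` is what the cocycle rule
  -- would give from `b` on representatives and `c` on `P`. The cochain `b₁` is congruent to `b`
  -- modulo `K`, and satisfies the cocycle rule exactly for right multiplication by `P` and `V`.
  let b₁ : Γ → M := fun g => b ((g : Γ ⧸ U).out) + ρ ((g : Γ ⧸ U).out) (c (x g))
  have hρg : ∀ g, ρ g = ρ ((g : Γ ⧸ U).out * x g) := fun g => by
    conv_lhs => rw [show g = ((g : Γ ⧸ U).out * x g) * ((x g : Γ)⁻¹ * (((g : Γ ⧸ U).out)⁻¹ * g)) by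
      group]
    exact hρV _ _ (hx g)
  have hb₁b : ∀ g, b₁ g - b g ∈ K := fun g => by
    have h1 : b g = b ((g : Γ ⧸ U).out * x g) := by
      conv_lhs => rw [show g = ((g : Γ ⧸ U).out * x g) *
        ((x g : Γ)⁻¹ * (((g : Γ ⧸ U).out)⁻¹ * g)) by group]
      exact hbV _ _ (hx g)
    have h2 := hbK ((g : Γ ⧸ U).out) (x g)
    have h3 := hK ((g : Γ ⧸ U).out) _ (hcb (x g))
    have h4 := K.add_mem h2 h3
    rw [← h1, map_sub] at h4
    convert h4 using 1
    simp only [b₁]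
    abel
  have hb₁mul : ∀ g, ∀ y : P, ∀ v ∈ V, b₁ (g * (y * v)) = b₁ g + ρ g (c y) := fun g y v hv => by
    have hq : ((g * (y * v) : Γ) : Γ ⧸ U) = (g : Γ ⧸ U) := by
      rw [eq_comm, QuotientGroup.eq]
      simpa using U.mul_mem ((le_sup_left : P ≤ U) y.2) ((le_sup_right : V ≤ U) hv)
    have h1 : c (x (g * (y * v))) = c (x g * y) := by
      refine (hcV _ _ ?_).symm
      have h2 := hx (g * (y * v))
      rw [hq] at h2
      have h3 := hx g
      have h4 : (y : Γ)⁻¹ * ((x g : Γ)⁻¹ * (((g : Γ ⧸ U).out)⁻¹ * g)) * (y : Γ)⁻¹⁻¹ ∈ V :=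
        Subgroup.Normal.conj_mem ‹_› _ h3 _
      have h5 := V.mul_mem (V.mul_mem h4 hv) (V.inv_mem h2)
      convert h5 using 1
      push_cast
      group
    simp only [b₁, hq, h1, hcmul, map_add]
    rw [← add_assoc, hρg g, map_mul, Module.End.mul_apply]
  have hc1 : c 1 = 0 := by simpa using hcmul 1 1
  have hb₁V : ∀ g, ∀ v ∈ V, b₁ (g * v) = b₁ g := fun g v hv => by
    simpa [hc1] using hb₁mul g 1 v hv
  have : Finite (Γ ⧸ U) := Subgroup.quotient_finite_of_isOpen U hUo
  let := Fintype.ofFinite (Γ ⧸ U)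
  have hcop := hP.coprime_index U hUo le_sup_left
  obtain ⟨k, hk⟩ := exists_nsmul_inverse hM (Nat.Coprime.pow_left s hcop)
  -- Each `T g a` would equal `b₁ g` if `b₁` were a cocycle. By the exact rule on the right it
  -- depends only on the coset `aU`, so it can be averaged; since `T (g h) a = T g (h a) + ρ g (T h
  -- a)`, the sum over cosets is a cocycle.
  let T : Γ → Γ → M := fun g a => b₁ (g * a) - ρ g (b₁ a)
  have hwd : ∀ g a a' : Γ, (a : Γ ⧸ U) = a' → T g a = T g a' := fun g a a' haa => by
    obtain ⟨y, hy, v, hv, hyv⟩ := Subgroup.mem_sup_of_normal_right.1 (QuotientGroup.eq.1 haa)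
    have h2 : a' = a * (y * v) := by rw [hyv]; simp
    have h3 := hb₁mul a ⟨y, hy⟩ v hv
    have h4 := hb₁mul (g * a) ⟨y, hy⟩ v hv
    simp only at h3 h4
    simp only [T, h2]
    rw [h3, ← mul_assoc, h4, map_add (ρ g) (b₁ a), map_mul, Module.End.mul_apply, add_sub_add_right_eq_sub]
  have hTK : ∀ g a, T g a - b g ∈ K := fun g a => by
    have h1 := hb₁b (g * a)
    have h2 := hK g _ (hb₁b a)
    have h3 := K.sub_mem (K.sub_mem h1 h2) (hbK g a)
    convert h3 using 1
    simp only [T, map_sub]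
    abel
  let S : Γ → M := fun g => ∑ q : Γ ⧸ U, T g q.out
  have hSmul : ∀ g h, S (g * h) = S g + ρ g (S h) := fun g h => by
    have h1 : S g = ∑ q : Γ ⧸ U, T g (h * q.out) := by
      calc S g = ∑ q : Γ ⧸ U, T g (h • q).out :=
            (Equiv.sum_comp (MulAction.toPerm h) (fun q : Γ ⧸ U => T g q.out)).symm
        _ = _ := by
            refine Finset.sum_congr rfl fun q _ => hwd _ _ _ ?_
            rw [QuotientGroup.out_eq', ← smul_eq_mul, ← MulAction.Quotient.smul_coe,
              QuotientGroup.out_eq']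
    rw [h1, map_sum, ← Finset.sum_add_distrib]
    refine Finset.sum_congr rfl fun q _ => ?_
    simp only [T, map_sub, mul_assoc, map_mul, Module.End.mul_apply]
    abel
  refine ⟨fun g => k • S g, ?_, fun g h => ?_, fun g => ?_⟩
  · refine IsLocallyConstant.of_coset V hVo fun g v hv => ?_
    congr 1
    refine Finset.sum_congr rfl fun q _ => ?_
    have h1 : b₁ (g * v * q.out) = b₁ (g * q.out) := by
      have h2 := hb₁V (g * q.out) (q.out⁻¹ * v * q.out⁻¹⁻¹) (Subgroup.Normal.conj_mem ‹_› _ hv _)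
      rw [← h2]
      congr 1
      group
    simp only [T, h1, hρV g v hv]
  · simp only [hSmul, smul_add, map_nsmul]
  · have h1 : S g - U.index • b g ∈ K := by
      have : S g - U.index • b g = ∑ q : Γ ⧸ U, (T g q.out - b g) := by
        simp [S, Subgroup.index, Nat.card_eq_fintype_card]
      rw [this]
      exact K.sum_mem fun q _ => hTK _ _
    have h2 := K.smul_of_tower_mem k h1
    rwa [smul_sub, hk] at h2

/-- A locally constant homomorphism from a pro-`p`-group to `𝔽_pˣ` is trivial. -/
theorem IsProP.eq_one_of_isLocallyConstant {G : Type*} [Group G] [TopologicalSpace G]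
    [Fact p.Prime] (hG : IsProP p G) (φ : G →* (ZMod p)ˣ) (hφ : IsLocallyConstant φ) (g : G) :
    φ g = 1 := by
  have hopen : IsOpen (φ.ker : Set G) := hφ.isOpen_fiber 1
  obtain ⟨k, hk⟩ := hG φ.ker inferInstance hopen (g : G ⧸ φ.ker)
  rw [← QuotientGroup.mk_pow, QuotientGroup.eq_one_iff, MonoidHom.mem_ker, map_pow] at hk
  have h2 : (φ g : ZMod p) ^ p ^ k = 1 := by
    rw [← Units.val_pow_eq_pow_val, hk, Units.val_one]
  -- Frobenius is the identity on `𝔽_p`, so an element of `p`-power order in `𝔽_pˣ` is trivial.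
  rw [ZMod.pow_card_pow] at h2
  exact Units.ext h2

end Transfer

/-! ## Arithmetic in `ℤ/p^(r+1)` -/

theorem ZMod.natCast_dvd_of_mul_eq_zero {n a b : ℕ} (hab : a * b = n) (ha : a ≠ 0) [NeZero n]
    {x : ZMod n} (h : (a : ZMod n) * x = 0) : (b : ZMod n) ∣ x := by
  rw [← ZMod.natCast_zmod_val x] at h ⊢
  rw [← Nat.cast_mul, ZMod.natCast_eq_zero_iff] at h
  exact Nat.cast_dvd_cast (Nat.dvd_of_mul_dvd_mul_left (Nat.pos_of_ne_zero ha)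
    ((dvd_of_eq hab).trans h))

theorem ZMod.castHom_eq_zero_iff_dvd {n m : ℕ} (hmn : m ∣ n) [NeZero n] {x : ZMod n} :
    ZMod.castHom hmn (ZMod m) x = 0 ↔ (m : ZMod n) ∣ x := by
  constructor
  · intro h
    rw [← ZMod.natCast_zmod_val x] at h ⊢
    rw [map_natCast, ZMod.natCast_eq_zero_iff] at h
    exact Nat.cast_dvd_cast h
  · rintro ⟨y, rfl⟩
    rw [map_mul, map_natCast, ZMod.natCast_self, zero_mul]

/-- Because the chosen quotient is a function of the dividend alone, dividing a locally constant
function by `c` keeps it locally constant. -/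
theorem exists_mul_section {R : Type*} [CommRing R] (c : R) :
    ∃ s : R → R, ∀ x, c ∣ x → x = c * s x := by
  classical
  exact ⟨fun x => if h : c ∣ x then h.choose else 0, fun x h => by
    simpa [h] using h.choose_spec⟩

section Reduction

variable (p : ℕ) [Fact p.Prime] (r : ℕ)

/-- The reduction map `ℤ/p^(r+1) → 𝔽_p`. -/
abbrev reductionModP : ZMod (p ^ (r + 1)) →+* ZMod p :=
  ZMod.castHom (dvd_pow_self p r.succ_ne_zero) (ZMod p)

variable {p r}

theorem reductionModP_eq_zero_iff {x : ZMod (p ^ (r + 1))} :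
    reductionModP p r x = 0 ↔ (p : ZMod (p ^ (r + 1))) ∣ x :=
  ZMod.castHom_eq_zero_iff_dvd _

theorem pow_mul_eq_zero_iff {x : ZMod (p ^ (r + 1))} :
    (p : ZMod (p ^ (r + 1))) ^ r * x = 0 ↔ reductionModP p r x = 0 := by
  rw [reductionModP_eq_zero_iff]
  constructor
  · intro h
    exact ZMod.natCast_dvd_of_mul_eq_zero (pow_succ p r).symm
      (pow_ne_zero _ (Fact.out : p.Prime).ne_zero) (by exact_mod_cast h)
  · rintro ⟨y, rfl⟩
    rw [← mul_assoc, ← pow_succ]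
    have : (p : ZMod (p ^ (r + 1))) ^ (r + 1) = 0 := by exact_mod_cast ZMod.natCast_self _
    rw [this, zero_mul]

theorem pow_mul_eq_pow_mul_iff {x y : ZMod (p ^ (r + 1))} :
    (p : ZMod (p ^ (r + 1))) ^ r * x = (p : ZMod (p ^ (r + 1))) ^ r * y ↔
      reductionModP p r x = reductionModP p r y := by
  rw [← sub_eq_zero, ← mul_sub, pow_mul_eq_zero_iff, map_sub, sub_eq_zero]

theorem pow_dvd_of_mul_eq_zero {x : ZMod (p ^ (r + 1))} (h : (p : ZMod (p ^ (r + 1))) * x = 0) :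
    (p : ZMod (p ^ (r + 1))) ^ r ∣ x := by
  exact_mod_cast ZMod.natCast_dvd_of_mul_eq_zero (pow_succ' p r).symm
    (Fact.out : p.Prime).ne_zero h

theorem castHom_eq_zero_iff_pow_dvd {x : ZMod (p ^ (r + 1))} :
    ZMod.castHom (pow_dvd_pow p r.le_succ) (ZMod (p ^ r)) x = 0 ↔
      (p : ZMod (p ^ (r + 1))) ^ r ∣ x := by
  rw [ZMod.castHom_eq_zero_iff_dvd, Nat.cast_pow]

theorem exists_reductionModP_section :
    ∃ s : ZMod p → ZMod (p ^ (r + 1)), ∀ x, reductionModP p r (s x) = x :=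
  ⟨_, Function.surjInv_eq (ZMod.ringHom_surjective (reductionModP p r))⟩

end Reduction

/-! ## Lifting rank one cocycles -/

/-- If all cocycles modulo `p` lift to `ℤ/p^(r+1)`, then so do all cocycles modulo `p^t`. -/
theorem exists_cocycle_lift_of_mod_p {p : ℕ} [Fact p.Prime] {r : ℕ} {G : Type*} [Group G]
    [TopologicalSpace G] (χ : G → ZMod (p ^ (r + 1)))
    (hχ : ∀ a : G → ZMod p, IsLocallyConstant a →
      (∀ g h, a (g * h) = a g + reductionModP p r (χ g) * a h) →
      ∃ q : G → ZMod (p ^ (r + 1)), IsLocallyConstant q ∧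
        (∀ g h, q (g * h) = q g + χ g * q h) ∧ ∀ g, reductionModP p r (q g) = a g)
    (t : ℕ) (ht : t ≤ r + 1) (q : G → ZMod (p ^ (r + 1))) (hq : IsLocallyConstant q)
    (hqt : ∀ g h, (p : ZMod (p ^ (r + 1))) ^ t ∣ q g + χ g * q h - q (g * h)) :
    ∃ q' : G → ZMod (p ^ (r + 1)), IsLocallyConstant q' ∧
      (∀ g h, q' (g * h) = q' g + χ g * q' h) ∧
      ∀ g, (p : ZMod (p ^ (r + 1))) ^ t ∣ q' g - q g := by
  induction t generalizing q with
  | zero => exact ⟨fun _ => 0, IsLocallyConstant.const 0, by simp, by simp⟩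
  | succ t ih =>
    -- Dévissage: subtract a cocycle `Q` with the same reduction modulo `p`, divide the difference
    -- by `p`, and treat the quotient as a cocycle modulo `p^t`.
    obtain ⟨Q, hQ, hQmul, hQq⟩ := hχ (fun g => reductionModP p r (q g)) (hq.comp _) (fun g h => by
      have h1 := (dvd_pow_self (p : ZMod (p ^ (r + 1))) t.succ_ne_zero).trans (hqt g h)
      rw [← reductionModP_eq_zero_iff, map_sub, map_add, map_mul, sub_eq_zero] at h1
      exact h1.symm)
    obtain ⟨s, hs⟩ := exists_mul_section (p : ZMod (p ^ (r + 1)))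
    have hw : ∀ g, q g - Q g = p * s (q g - Q g) := fun g => hs _ (by
      rw [← reductionModP_eq_zero_iff, map_sub, hQq, sub_self])
    obtain ⟨w', hw', hwmul, hww⟩ := ih (by omega) (fun g => s (q g - Q g))
      ((hq.sub hQ).comp _) (fun g h => by
        obtain ⟨y, hy⟩ := hqt g h
        have h1 : (p : ZMod (p ^ (r + 1))) * (s (q g - Q g) + χ g * s (q h - Q h) -
            s (q (g * h) - Q (g * h)) - p ^ t * y) = 0 := by
          linear_combination hy - hw g - χ g * hw h + hw (g * h) + hQmul g h
        -- Cancelling `p` in `ℤ/p^(r+1)` leaves an identity known only modulo `p^r`, which suffices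
        -- because `t ≤ r`.
        have h2 := (pow_dvd_pow (p : ZMod (p ^ (r + 1))) (by omega : t ≤ r)).trans
          (pow_dvd_of_mul_eq_zero h1)
        exact (dvd_sub_left (dvd_mul_right _ _)).1 h2)
    refine ⟨fun g => Q g + p * w' g, hQ.add (hw'.comp (fun x => (p : ZMod (p ^ (r + 1))) * x)),
      fun g h => ?_, fun g => ?_⟩
    · linear_combination hQmul g h + (p : ZMod (p ^ (r + 1))) * hwmul g h
    · obtain ⟨y, hy⟩ := hww g
      exact ⟨y, by linear_combination (p : ZMod (p ^ (r + 1))) * hy - hw g⟩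

/-! ## Surjectivity of the cup product -/

/-- Cup product with any non-zero `a ∈ H¹(G, 𝔽_p)` is onto `H²(G, 𝔽_p)`, in terms of cochains. -/
def CupSurjective (p : ℕ) (G : Type*) [Group G] [TopologicalSpace G] : Prop :=
  ∀ a : G → ZMod p, IsLocallyConstant a → (∀ g h, a (g * h) = a g + a h) → (∃ g, a g ≠ 0) →
    ∀ f : G × G → ZMod p, IsLocallyConstant f →
      (∀ g h k, f (h, k) + f (g, h * k) = f (g * h, k) + f (g, h)) →
      ∃ β ψ : G → ZMod p, IsLocallyConstant β ∧ IsLocallyConstant ψ ∧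
        (∀ g h, β (g * h) = β g + β h) ∧
        ∀ g h, f (g, h) = a g * β h + (ψ h - ψ (g * h) + ψ g)

/-- A nonzero class lies outside the left kernel, so its cup product with some class is nonzero;
`H²` is a line, so multiples of that product fill it. -/
theorem IsDemuskin.cupSurjective {p : ℕ} [Fact p.Prime] {G : Type*} [Group G] [TopologicalSpace G]
    (hG : IsDemuskin p G) : CupSurjective p G := by
  intro a ha hamul ⟨g₀, hg₀⟩ f hf hfmul
  let a' : ContCoh.Z1 (Representation.trivial (ZMod p) G (ZMod p)) := ⟨a, ha, by simpa using hamul⟩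
  let f' : ContCoh.Z2 (Representation.trivial (ZMod p) G (ZMod p)) := ⟨f, hf, by simpa using hfmul⟩
  have h1 : ContCoh.cup G (ZMod p) (Submodule.Quotient.mk a') ≠ 0 := fun h => by
    have h2 : (Submodule.Quotient.mk a' :
        ContCoh.H1 (Representation.trivial (ZMod p) G (ZMod p))) = 0 := by
      have := hG.left_kernel ▸ (LinearMap.mem_ker.2 h)
      simpa using this
    have h3 := ContCoh.eq_zero_of_mem_B1_trivial G (ZMod p) a'
      ((Submodule.Quotient.mk_eq_zero _).1 h2)
    exact hg₀ (congrFun (congrArg Subtype.val h3) g₀)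
  obtain ⟨y, hy⟩ : ∃ y, ContCoh.cup G (ZMod p) (Submodule.Quotient.mk a') y ≠ 0 := by
    by_contra! h
    exact h1 (LinearMap.ext h)
  obtain ⟨b, rfl⟩ := Submodule.Quotient.mk_surjective _ y
  obtain ⟨c, hc⟩ := (finrank_eq_one_iff_of_nonzero' _ hy).1 hG.finrank_H2 (Submodule.Quotient.mk f')
  rw [ContCoh.cup_mk, ← Submodule.Quotient.mk_smul, eq_comm, Submodule.Quotient.eq] at hc
  obtain ⟨ψ, hψ, hψf⟩ := hc
  refine ⟨fun g => c * b.1 g, ψ, b.2.1.comp _, hψ, fun g h => ?_, fun g h => ?_⟩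
  · have := b.2.2 g h
    simp only [Representation.trivial_apply] at this
    change c * b.1 (g * h) = c * b.1 g + c * b.1 h
    rw [this, mul_add]
  · have h2 := congrFun hψf (g, h)
    change ψ h - ψ (g * h) + ψ g = f (g, h) - c * (a g * b.1 h) at h2
    rw [h2]
    ring

/-! ## Lifting cocycles with values in a triangular representation -/

section Triangular

variable {p : ℕ} [Fact p.Prime] {r d : ℕ} {G : Type*} [Group G]

/-- The failure of `b` to be a `1`-cocycle. -/
def cocycleDefect {R : Type*} [CommRing R] (B : G →* Matrix (Fin d) (Fin d) R) (b : G → Fin d → R)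
    (g h : G) : Fin d → R :=
  b g + (B g).mulVec (b h) - b (g * h)

theorem cocycleDefect_sub {R : Type*} [CommRing R] (B : G →* Matrix (Fin d) (Fin d) R)
    (b c : G → Fin d → R) (g h : G) :
    cocycleDefect B (b - c) g h = cocycleDefect B b g h - cocycleDefect B c g h := by
  simp only [cocycleDefect, Pi.sub_apply, Matrix.mulVec_sub]
  abel

/-- The defect is the coboundary of `b`, so this is `d ∘ d = 0`; it makes the obstruction below a
2-cocycle. -/
theorem cocycleDefect_cocycle {R : Type*} [CommRing R] (B : G →* Matrix (Fin d) (Fin d) R)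
    (b : G → Fin d → R) (g h k : G) :
    (B g).mulVec (cocycleDefect B b h k) + cocycleDefect B b g (h * k) =
      cocycleDefect B b (g * h) k + cocycleDefect B b g h := by
  simp only [cocycleDefect, Matrix.mulVec_sub, Matrix.mulVec_add, Matrix.mulVec_mulVec, map_mul,
    mul_assoc]
  abel

variable [TopologicalSpace G]

/-- The defect in row `k'` is `p^r F`, and `F` modulo `p` is a 2-cocycle with trivial coefficients
because the diagonal is 1 modulo `p`. Writing `F = a ∪ β + dψ`, with `a` the `(k', k)` entry modulo
`p`, one subtracts `p^r β` in coordinate `k` and `p^r ψ` in coordinate `k'`. Row `k` stays exact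
because `β` is a homomorphism, and lower rows are untouched by triangularity. -/
theorem exists_triangular_lift_step (hG : CupSurjective p G)
    (B : G →* Matrix (Fin d) (Fin d) (ZMod (p ^ (r + 1)))) (hB : IsLocallyConstant B)
    (htri : ∀ g i j, j < i → B g i j = 0) (hone : ∀ g i, reductionModP p r (B g i i) = 1)
    (k' k : Fin d) (hk : (k' : ℕ) + 1 = k) (hwound : ∃ g, reductionModP p r (B g k' k) ≠ 0)
    (b : G → Fin d → ZMod (p ^ (r + 1))) (hb : IsLocallyConstant b)
    (hbr : ∀ g h i, (p : ZMod (p ^ (r + 1))) ^ r ∣ cocycleDefect B b g h i)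
    (hbk : ∀ g h i, k ≤ i → cocycleDefect B b g h i = 0) [ContinuousMul G] :
    ∃ b' : G → Fin d → ZMod (p ^ (r + 1)), IsLocallyConstant b' ∧
      (∀ g i, (p : ZMod (p ^ (r + 1))) ^ r ∣ b' g i - b g i) ∧
      ∀ g h i, k' ≤ i → cocycleDefect B b' g h i = 0 := by
  have hlt : k' < k := by rw [Fin.lt_def]; omega
  obtain ⟨s, hs⟩ := exists_mul_section ((p : ZMod (p ^ (r + 1))) ^ r)
  obtain ⟨l, hl⟩ := exists_reductionModP_section (p := p) (r := r)
  have hlc : IsLocallyConstant (fun x : G × G => cocycleDefect B b x.1 x.2) := by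
    have h1 : IsLocallyConstant (fun x : G × G => (B x.1).mulVec (b x.2)) :=
      ((hB.comp_continuous continuous_fst).prodMk (hb.comp_continuous continuous_snd)).comp
        (fun y => y.1.mulVec y.2)
    exact ((hb.comp_continuous continuous_fst).add h1).sub (hb.comp_continuous continuous_mul)
  let F : G × G → ZMod (p ^ (r + 1)) := fun x => s (cocycleDefect B b x.1 x.2 k')
  have hF : ∀ g h, cocycleDefect B b g h k' = p ^ r * F (g, h) := fun g h => hs _ (hbr g h k')
  -- The superdiagonal entry is additive modulo `p` since the diagonal entries on either side are 1
  -- there.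
  obtain ⟨β, ψ, hβ, hψ, hβmul, hβψ⟩ := hG (fun g => reductionModP p r (B g k' k))
    (hB.comp (fun X => reductionModP p r (X k' k)))
    (fun g h => by
      rw [map_mul, Matrix.mul_apply, Finset.sum_eq_add k' k hlt.ne, map_add, map_mul, map_mul,
        hone, hone, one_mul, mul_one, add_comm]
      · rintro c - ⟨hc, hc'⟩
        rcases lt_or_gt_of_ne hc with h1 | h1
        · rw [htri g _ _ h1, zero_mul]
        · rw [htri h c k, mul_zero]
          rw [Fin.lt_def] at h1 ⊢
          have : (c : ℕ) ≠ k := fun h => hc' (Fin.ext h)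
          omega
      all_goals simp)
    hwound (fun x => reductionModP p r (F x))
    (hlc.comp (fun v => reductionModP p r (s (v k'))))
    (fun g h k₁ => by
      have h1 := congrFun (cocycleDefect_cocycle B b g h k₁) k'
      have h2 : (B g).mulVec (cocycleDefect B b h k₁) k' =
          B g k' k' * cocycleDefect B b h k₁ k' := by
        rw [Matrix.mulVec, dotProduct, Finset.sum_eq_single k']
        · intro c _ hc
          rcases lt_or_gt_of_ne hc with h3 | h3
          · rw [htri g _ _ h3, zero_mul]
          · rw [hbk h k₁ c, mul_zero]
            rw [Fin.lt_def] at h3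
            rw [Fin.le_def]
            omega
        · simp
      rw [Pi.add_apply, Pi.add_apply, h2, hF, hF, hF, hF, ← mul_add, mul_left_comm, ← mul_add,
        pow_mul_eq_pow_mul_iff, map_add, map_add, map_mul, hone, one_mul] at h1
      exact h1)
  let e : G → Fin d → ZMod (p ^ (r + 1)) := fun g =>
    Pi.single k (p ^ r * l (β g)) + Pi.single k' (p ^ r * l (ψ g))
  have he : IsLocallyConstant e := by
    have h1 : IsLocallyConstant fun g =>
        (Pi.single k (p ^ r * l (β g)) : Fin d → ZMod (p ^ (r + 1))) :=
      hβ.comp fun y => (Pi.single k (p ^ r * l y) : Fin d → ZMod (p ^ (r + 1)))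
    have h2 : IsLocallyConstant fun g =>
        (Pi.single k' (p ^ r * l (ψ g)) : Fin d → ZMod (p ^ (r + 1))) :=
      hψ.comp fun y => (Pi.single k' (p ^ r * l y) : Fin d → ZMod (p ^ (r + 1)))
    exact h1.add h2
  have hde : ∀ g h i, cocycleDefect B e g h i =
      e g i + (B g i k * (p ^ r * l (β h)) + B g i k' * (p ^ r * l (ψ h))) - e (g * h) i := by
    intro g h i
    simp [cocycleDefect, e, Matrix.mulVec_add]
  refine ⟨b - e, hb.sub he, fun g i => ?_, fun g h i hi => ?_⟩
  · have h1 : (p : ZMod (p ^ (r + 1))) ^ r ∣ e g i := by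
      refine dvd_add ?_ ?_
      · by_cases h : i = k
        · subst h; simp
        · simp [h]
      · by_cases h : i = k'
        · subst h; simp
        · simp [h]
    simpa using h1
  · rw [cocycleDefect_sub, Pi.sub_apply, sub_eq_zero, hde]
    rcases eq_or_lt_of_le hi with rfl | hi
    · have h1 : ∀ g, e g k' = p ^ r * l (ψ g) := fun g => by simp [e, hlt.ne]
      rw [h1, h1, hF]
      have h2 : (p : ZMod (p ^ (r + 1))) ^ r * F (g, h) = p ^ r * (l (ψ g) + (B g k' k * l (β h) +
          B g k' k' * l (ψ h)) - l (ψ (g * h))) := by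
        rw [pow_mul_eq_pow_mul_iff]
        have := hβψ g h
        simp only [map_add, map_sub, map_mul, hl, hone]
        rw [this]
        ring
      rw [h2]
      ring
    · have hki : k ≤ i := by rw [Fin.lt_def] at hi; rw [Fin.le_def]; omega
      rw [hbk g h i hki, htri g i k' hi]
      rcases eq_or_lt_of_le hki with rfl | hki
      · have h1 : ∀ g, e g k = p ^ r * l (β g) := fun g => by simp [e, hlt.ne']
        rw [h1, h1]
        have h2 : (p : ZMod (p ^ (r + 1))) ^ r * (l (β g) + B g k k * l (β h)) =
            p ^ r * l (β (g * h)) := by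
          rw [pow_mul_eq_pow_mul_iff]
          simp only [map_add, map_mul, hl, hone, hβmul, one_mul]
        linear_combination -h2
      · have h1 : ∀ g, e g i = 0 := fun g => by simp [e, hi.ne', hki.ne']
        rw [htri g i k hki, h1, h1]
        ring

/-- A cocycle modulo `p^r` with values in a wound triangular representation lifts as soon as its
last component does. -/
theorem exists_triangular_lift (hG : CupSurjective p G)
    (B : G →* Matrix (Fin d) (Fin d) (ZMod (p ^ (r + 1)))) (hB : IsLocallyConstant B)
    (htri : ∀ g i j, j < i → B g i j = 0) (hone : ∀ g i, reductionModP p r (B g i i) = 1)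
    (hwound : ∀ k' k : Fin d, (k' : ℕ) + 1 = k → ∃ g, reductionModP p r (B g k' k) ≠ 0)
    (b : G → Fin d → ZMod (p ^ (r + 1))) (hb : IsLocallyConstant b)
    (hbr : ∀ g h i, (p : ZMod (p ^ (r + 1))) ^ r ∣ cocycleDefect B b g h i)
    (hlast : ∀ g h (i : Fin d), (i : ℕ) + 1 = d → cocycleDefect B b g h i = 0) [ContinuousMul G] :
    ∃ b' : G → Fin d → ZMod (p ^ (r + 1)), IsLocallyConstant b' ∧
      (∀ g i, (p : ZMod (p ^ (r + 1))) ^ r ∣ b' g i - b g i) ∧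
      ∀ g h i, cocycleDefect B b' g h i = 0 := by
  -- Induction upwards from the bottom row: at stage `n` the last `n + 1` rows are exact, and `n =
  -- 0` is `hlast`.
  suffices H : ∀ n : ℕ, ∃ b' : G → Fin d → ZMod (p ^ (r + 1)), IsLocallyConstant b' ∧
      (∀ g i, (p : ZMod (p ^ (r + 1))) ^ r ∣ b' g i - b g i) ∧
      ∀ g h (i : Fin d), d ≤ i + 1 + n → cocycleDefect B b' g h i = 0 by
    obtain ⟨b', h1, h2, h3⟩ := H d
    exact ⟨b', h1, h2, fun g h i => h3 g h i (by omega)⟩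
  intro n
  induction n with
  | zero => exact ⟨b, hb, by simp, fun g h i hi => hlast g h i (by omega)⟩
  | succ n ih =>
    obtain ⟨b₁, hb₁, hb₁b, hb₁n⟩ := ih
    by_cases hn : n + 2 ≤ d
    swap
    · exact ⟨b₁, hb₁, hb₁b, fun g h i _ => hb₁n g h i (by omega)⟩
    have hdvd : ∀ g h i, (p : ZMod (p ^ (r + 1))) ^ r ∣ cocycleDefect B b₁ g h i := fun g h i => by
      have h1 := cocycleDefect_sub B b₁ b g h
      have h2 : (p : ZMod (p ^ (r + 1))) ^ r ∣ cocycleDefect B (b₁ - b) g h i := by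
        refine dvd_sub (dvd_add (hb₁b g i) ?_) (hb₁b _ i)
        change _ ∣ ∑ j, B g i j * (b₁ h j - b h j)
        exact Finset.dvd_sum fun j _ => Dvd.dvd.mul_left (hb₁b h j) (B g i j)
      rw [h1, Pi.sub_apply] at h2
      exact (dvd_sub_left (hbr g h i)).1 h2
    obtain ⟨b₂, hb₂, hb₂b, hb₂n⟩ := exists_triangular_lift_step hG B hB htri hone
      ⟨d - (n + 2), by omega⟩ ⟨d - (n + 1), by omega⟩ (by simp; omega) (hwound _ _ (by simp; omega))
      b₁ hb₁ hdvd (fun g h i hi => hb₁n g h i (by rw [Fin.le_def] at hi; simp at hi; omega))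
    refine ⟨b₂, hb₂, fun g i => ?_, fun g h i hi => hb₂n g h i (by rw [Fin.le_def]; simp; omega)⟩
    simpa using dvd_add (hb₂b g i) (hb₁b g i)

end Triangular

/-! ### Lifting wound triangular homomorphisms over a manageable group -/

section Core

variable {p : ℕ} [Fact p.Prime] {r d : ℕ} {Γ : Type*} [Group Γ]

/-- Continuous cocycles modulo `p` with values in the character `χ mod p` lift to cocycles with
values in `χ`. -/
def CocyclesLift [TopologicalSpace Γ] (χ : Γ →* (ZMod (p ^ (r + 1)))ˣ) : Prop :=
  ∀ a : Γ → ZMod p, IsLocallyConstant a →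
    (∀ g h, a (g * h) = a g + reductionModP p r (χ g) * a h) →
    ∃ q : Γ → ZMod (p ^ (r + 1)), IsLocallyConstant q ∧
      (∀ g h, q (g * h) = q g + χ g * q h) ∧ ∀ g, reductionModP p r (q g) = a g

theorem Matrix.diag_mul_of_triangular {R : Type*} [CommRing R] {X Y : Matrix (Fin d) (Fin d) R}
    (hX : ∀ i j, j < i → X i j = 0) (hY : ∀ i j, j < i → Y i j = 0) (i : Fin d) :
    (X * Y) i i = X i i * Y i i := by
  rw [Matrix.mul_apply, Finset.sum_eq_single i]
  · intro c _ hc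
    rcases lt_or_gt_of_ne hc with h1 | h1
    · rw [hX _ _ h1, zero_mul]
    · rw [hY _ _ h1, mul_zero]
  · simp

theorem Matrix.superdiag_mul_of_triangular {R : Type*} [CommRing R]
    {X Y : Matrix (Fin d) (Fin d) R}
    (hX : ∀ i j, j < i → X i j = 0) (hY : ∀ i j, j < i → Y i j = 0) {i j : Fin d}
    (hij : (i : ℕ) + 1 = j) : (X * Y) i j = X i i * Y i j + X i j * Y j j := by
  rw [Matrix.mul_apply, Finset.sum_eq_add i j]
  · rintro rfl; omega
  · rintro c - ⟨hc, hc'⟩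
    rcases lt_or_gt_of_ne hc with h1 | h1
    · rw [hX _ _ h1, zero_mul]
    · rw [hY c j, mul_zero]
      rw [Fin.lt_def] at h1 ⊢
      have : (c : ℕ) ≠ j := fun h => hc' (Fin.ext h)
      omega
  all_goals simp

/-- The representation on column vectors attached to a homomorphism to matrices. -/
def matrixRep {R : Type*} [CommRing R] (B : Γ →* Matrix (Fin d) (Fin d) R) :
    Representation R Γ (Fin d → R) :=
  (Matrix.toLinAlgEquiv' : Matrix (Fin d) (Fin d) R ≃ₐ[R] _).toMonoidHom.comp B

variable [TopologicalSpace Γ] [IsTopologicalGroup Γ] [CompactSpace Γ] [T2Space Γ] [TotallyDisconnectedSpace Γ]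

theorem exists_matrix_cocycle_of_exists_on_sylow {P : Subgroup Γ} (hP : IsProPSylow p P)
    (B : Γ →* Matrix (Fin d) (Fin d) (ZMod (p ^ (r + 1)))) (hB : IsLocallyConstant B)
    (b : Γ → Fin d → ZMod (p ^ (r + 1))) (hb : IsLocallyConstant b)
    (hbr : ∀ g h i, (p : ZMod (p ^ (r + 1))) ^ r ∣ cocycleDefect B b g h i)
    (c : P → Fin d → ZMod (p ^ (r + 1))) (hc : IsLocallyConstant c)
    (hcb : ∀ (x : P) i, (p : ZMod (p ^ (r + 1))) ^ r ∣ c x i - b x i)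
    (hcmul : ∀ x y i, cocycleDefect (B.comp P.subtype) c x y i = 0) :
    ∃ b' : Γ → Fin d → ZMod (p ^ (r + 1)), IsLocallyConstant b' ∧
      (∀ g i, (p : ZMod (p ^ (r + 1))) ^ r ∣ b' g i - b g i) ∧
      ∀ g h i, cocycleDefect B b' g h i = 0 := by
  let K : Submodule (ZMod (p ^ (r + 1))) (Fin d → ZMod (p ^ (r + 1))) :=
    Submodule.pi Set.univ fun _ => Ideal.span {(p : ZMod (p ^ (r + 1))) ^ r}
  have hKmem : ∀ v, v ∈ K ↔ ∀ i, (p : ZMod (p ^ (r + 1))) ^ r ∣ v i := fun v => by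
    simp [K, Submodule.mem_pi, Ideal.mem_span_singleton]
  obtain ⟨b', h1, h2, h3⟩ := exists_cocycle_of_exists_on_sylow (s := r + 1) (fun m => by
      rw [← Nat.cast_smul_eq_nsmul (ZMod (p ^ (r + 1))), ZMod.natCast_self, zero_smul]) hP
    (matrixRep B)
    (hB.comp (Matrix.toLinAlgEquiv' (R := ZMod (p ^ (r + 1))) (n := Fin d))) K
    (fun g m hm => (hKmem _).2 fun i => by
      change _ ∣ ∑ j, B g i j * m j
      exact Finset.dvd_sum fun j _ => Dvd.dvd.mul_left ((hKmem _).1 hm j) (B g i j)) hb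
    (fun g h => (hKmem _).2 (hbr g h)) hc
    (fun x y => (sub_eq_zero.1 (funext (hcmul x y))).symm) (fun x => (hKmem _).2 (hcb x))
  exact ⟨b', h1, fun g => (hKmem _).1 (h3 g), fun g h i =>
    congrFun (sub_eq_zero.2 (h2 g h).symm) i⟩

variable {P₁ P₂ : Subgroup Γ}

/-- Over a manageable group, a cocycle modulo `p^r` with values in a wound triangular
representation whose last diagonal character is essentially the cyclotomic one lifts. -/
theorem exists_wound_cocycle_lift (hP₁ : IsProPSylow p P₁) (hP₂ : IsProPSylow p P₂)
    (χ : Γ →* (ZMod (p ^ (r + 1)))ˣ) (hχ : CocyclesLift (χ.comp P₁.subtype))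
    (hcup : CupSurjective p P₂)
    (B : Γ →* Matrix (Fin d) (Fin d) (ZMod (p ^ (r + 1)))) (hB : IsLocallyConstant B)
    (htri : ∀ g i j, j < i → B g i j = 0)
    (hlast : ∀ x ∈ P₁, ∀ i : Fin d, (i : ℕ) + 1 = d → B x i i = χ x)
    (hone : ∀ x ∈ P₂, ∀ i, reductionModP p r (B x i i) = 1)
    (hwound : ∀ k' k : Fin d, (k' : ℕ) + 1 = k → ¬ ∃ m, ∀ g, reductionModP p r (B g k' k) =
      m * (reductionModP p r (B g k k) - reductionModP p r (B g k' k')))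
    (b : Γ → Fin d → ZMod (p ^ (r + 1))) (hb : IsLocallyConstant b)
    (hbr : ∀ g h i, (p : ZMod (p ^ (r + 1))) ^ r ∣ cocycleDefect B b g h i) :
    ∃ b' : Γ → Fin d → ZMod (p ^ (r + 1)), IsLocallyConstant b' ∧
      (∀ g i, (p : ZMod (p ^ (r + 1))) ^ r ∣ b' g i - b g i) ∧
      ∀ g h i, cocycleDefect B b' g h i = 0 := by
  have hdiag : ∀ g h i, B (g * h) i i = B g i i * B h i i := fun g h i => by
    rw [map_mul, Matrix.diag_mul_of_triangular (htri g) (htri h)]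
  obtain _ | e := d
  · exact ⟨b, hb, by simp, fun g h i => i.elim0⟩
  have hdl : ∀ (c : Γ → Fin (e + 1) → ZMod (p ^ (r + 1))) g h,
      cocycleDefect B c g h (Fin.last e) =
      c g (Fin.last e) + B g (Fin.last e) (Fin.last e) * c h (Fin.last e) -
        c (g * h) (Fin.last e) := fun c g h => by
    have : (B g).mulVec (c h) (Fin.last e) =
        B g (Fin.last e) (Fin.last e) * c h (Fin.last e) := by
      rw [Matrix.mulVec, dotProduct, Finset.sum_eq_single (Fin.last e)]
      · intro j _ hj
        rw [htri g _ _ (Fin.lt_last_iff_ne_last.2 hj), zero_mul]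
      · simp
    simp [cocycleDefect, this]
  -- The bottom coordinate is itself a cocycle modulo `p^r` for the last diagonal character, which
  -- is `χ` on `P₁`. It is lifted there and then carried to `Γ` as `q`.
  obtain ⟨q₁, hq₁, hq₁mul, hq₁b⟩ := exists_cocycle_lift_of_mod_p
    (fun x : P₁ => (χ x : ZMod (p ^ (r + 1)))) hχ r (by omega)
    (fun x : P₁ => b x (Fin.last e))
    ((hb.comp (fun v => v (Fin.last e))).comp_continuous continuous_subtype_val)
    (fun x y => by
      have := hbr x y (Fin.last e)
      rw [hdl, hlast x x.2 _ rfl] at this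
      exact this)
  let ρ : Representation (ZMod (p ^ (r + 1))) Γ (ZMod (p ^ (r + 1))) :=
    { toFun := fun g => LinearMap.mulLeft _ (B g (Fin.last e) (Fin.last e))
      map_one' := by ext; simp
      map_mul' := fun g h => by ext; simp [hdiag] }
  have hρ : ∀ g x, ρ g x = B g (Fin.last e) (Fin.last e) * x := fun g x => rfl
  obtain ⟨q, hq, hqmul, hqb⟩ := exists_cocycle_of_exists_on_sylow (s := r + 1) (fun m => by
      rw [← Nat.cast_smul_eq_nsmul (ZMod (p ^ (r + 1))), ZMod.natCast_self, zero_smul]) hP₁ ρ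
    (hB.comp (fun X => LinearMap.mulLeft (ZMod (p ^ (r + 1))) (X (Fin.last e) (Fin.last e))))
    (Ideal.span {(p : ZMod (p ^ (r + 1))) ^ r}) (fun g m hm => Ideal.mul_mem_left _ _ hm)
    (hb.comp (fun v => v (Fin.last e)))
    (fun g h => by
      rw [Ideal.mem_span_singleton, hρ]
      have := hbr g h (Fin.last e)
      rwa [hdl] at this) hq₁
    (fun x y => by rw [hq₁mul, hρ, hlast x x.2 _ rfl])
    (fun x => Ideal.mem_span_singleton.2 (hq₁b x))
  let b₁ : Γ → Fin (e + 1) → ZMod (p ^ (r + 1)) := fun g => Function.update (b g) (Fin.last e) (q g)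
  have hb₁ : IsLocallyConstant b₁ :=
    (hb.prodMk hq).comp (fun y => Function.update y.1 (Fin.last e) y.2)
  have hb₁b : ∀ g i, (p : ZMod (p ^ (r + 1))) ^ r ∣ b₁ g i - b g i := fun g i => by
    by_cases h : i = Fin.last e
    · subst h
      simpa [b₁] using Ideal.mem_span_singleton.1 (hqb g)
    · simp [b₁, h]
  have hb₁r : ∀ g h i, (p : ZMod (p ^ (r + 1))) ^ r ∣ cocycleDefect B b₁ g h i := fun g h i => by
    have h1 := cocycleDefect_sub B b₁ b g h
    have h2 : (p : ZMod (p ^ (r + 1))) ^ r ∣ cocycleDefect B (b₁ - b) g h i := by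
      refine dvd_sub (dvd_add (hb₁b g i) ?_) (hb₁b _ i)
      change _ ∣ ∑ j, B g i j * (b₁ h j - b h j)
      exact Finset.dvd_sum fun j _ => Dvd.dvd.mul_left (hb₁b h j) (B g i j)
    rw [h1, Pi.sub_apply] at h2
    exact (dvd_sub_left (hbr g h i)).1 h2
  -- Woundness survives restriction to `P₂`. Otherwise the superdiagonal entry divided by the lower
  -- diagonal entry would be a cocycle over `𝔽_p` vanishing on a Sylow subgroup, hence a coboundary
  -- on `Γ`, which contradicts `hwound`.
  have hwP : ∀ k' k : Fin (e + 1), (k' : ℕ) + 1 = k →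
      ∃ x : P₂, reductionModP p r (B x k' k) ≠ 0 := by
    intro k' k hk
    by_contra! hcon
    have hu : ∀ g i, IsUnit (reductionModP p r (B g i i)) := fun g i => by
      refine IsUnit.of_mul_eq_one (reductionModP p r (B g⁻¹ i i)) ?_
      rw [← map_mul, ← hdiag, mul_inv_cancel, map_one, Matrix.one_apply_eq, map_one]
    have hu0 : ∀ g i, reductionModP p r (B g i i) ≠ 0 := fun g i => (hu g i).ne_zero
    let σ : Representation (ZMod p) Γ (ZMod p) :=
      { toFun := fun g => LinearMap.mulLeft _
          (reductionModP p r (B g k' k') / reductionModP p r (B g k k))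
        map_one' := by ext; simp
        map_mul' := fun g h => by
          ext
          simp only [hdiag, map_mul, LinearMap.mulLeft_apply, Module.End.mul_apply, mul_one,
            mul_div_mul_comm] }
    obtain ⟨m, hm⟩ := exists_coboundary_of_eq_zero_on_sylow (s := 1) (fun m : ZMod p => by
        rw [← Nat.cast_smul_eq_nsmul (ZMod p), pow_one, ZMod.natCast_self, zero_smul]) hP₂ σ
      (f := fun g => reductionModP p r (B g k' k) / reductionModP p r (B g k k))
      (hB.comp (fun X => reductionModP p r (X k' k) / reductionModP p r (X k k)))
      (fun g h => by
        have h1 := hu0 g k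
        have h2 := hu0 h k
        change _ = _ + reductionModP p r (B g k' k') / reductionModP p r (B g k k) *
          (reductionModP p r (B h k' k) / reductionModP p r (B h k k))
        rw [hdiag, map_mul B, Matrix.superdiag_mul_of_triangular (htri g) (htri h) hk, map_add,
          map_mul, map_mul, map_mul]
        field_simp
        ring)
      (fun x hx => by rw [hcon ⟨x, hx⟩, zero_div])
    refine hwound k' k hk ⟨m, fun g => ?_⟩
    have h1 : reductionModP p r (B g k' k) / reductionModP p r (B g k k) =
      m - reductionModP p r (B g k' k') / reductionModP p r (B g k k) * m := hm g
    have h2 := hu0 g k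
    field_simp at h1
    linear_combination h1
  obtain ⟨c, hc, hcb, hcmul⟩ := exists_triangular_lift hcup (B.comp P₂.subtype)
    (hB.comp_continuous continuous_subtype_val) (fun g => htri g) (fun x => hone x x.2) hwP
    (fun x => b₁ x) (hb₁.comp_continuous continuous_subtype_val) (fun x y => hb₁r x y)
    (fun x y i hi => by
      have : i = Fin.last e := Fin.ext (by simp at hi ⊢; omega)
      subst this
      refine (hdl b₁ x y).trans ?_
      have := hqmul x y
      rw [hρ] at this
      simp [b₁, this])
  obtain ⟨b', h1, h2, h3⟩ := exists_matrix_cocycle_of_exists_on_sylow hP₂ B hB b₁ hb₁ hb₁r c hc hcb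
    hcmul
  exact ⟨b', h1, fun g i => by simpa using dvd_add (h2 g i) (hb₁b g i), h3⟩

/-- Lifting of wound triangular homomorphisms with prescribed diagonal characters. -/
theorem exists_triangular_hom_lift (hP₁ : IsProPSylow p P₁) (hP₂ : IsProPSylow p P₂)
    (χ : Γ →* (ZMod (p ^ (r + 1)))ˣ) (hχ : CocyclesLift (χ.comp P₁.subtype))
    (hcup : CupSurjective p P₂) (hr : 1 ≤ r) (ψ : ℕ → Γ →* (ZMod (p ^ (r + 1)))ˣ)
    (hψ : ∀ i < d, IsLocallyConstant (ψ i))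
    (hψ₁ : ∀ i, i + 1 < d → ∀ x ∈ P₁, ψ i x = χ x * ψ (i + 1) x)
    (hψ₂ : ∀ i < d, ∀ x ∈ P₂, reductionModP p r (ψ i x) = 1)
    (A : Γ → ℕ → ℕ → ZMod (p ^ (r + 1))) (hA : IsLocallyConstant A)
    (htri : ∀ g i j, j < i → A g i j = 0)
    (hmul : ∀ g h i j, i < d → j < d → (p : ZMod (p ^ (r + 1))) ^ r ∣
      A (g * h) i j - ∑ k ∈ Finset.range d, A g i k * A h k j)
    (hdiag : ∀ g i, i < d → (p : ZMod (p ^ (r + 1))) ^ r ∣ A g i i - ψ i g)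
    (hwound : ∀ k, k + 1 < d → ¬ ∃ m, ∀ g, reductionModP p r (A g k (k + 1)) =
      m * (reductionModP p r (ψ (k + 1) g) - reductionModP p r (ψ k g))) :
    ∃ A' : Γ →* Matrix (Fin d) (Fin d) (ZMod (p ^ (r + 1))), IsLocallyConstant A' ∧
      (∀ g i j, j < i → A' g i j = 0) ∧ (∀ g (i : Fin d), A' g i i = ψ i g) ∧
      ∀ g (i j : Fin d), (p : ZMod (p ^ (r + 1))) ^ r ∣ A' g i j - A g i j := by
  induction d with
  | zero => exact ⟨1, IsLocallyConstant.const _, fun g i => i.elim0, fun g i => i.elim0,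
      fun g i => i.elim0⟩
  | succ d ih =>
    -- The block on the first `d` indices is multiplicative modulo `p^r` by itself, since the last
    -- row vanishes to the left of the diagonal.
    obtain ⟨A', hA', htri', hdiag', hA'A⟩ := ih (fun i hi => hψ i (by omega))
      (fun i hi => hψ₁ i (by omega)) (fun i hi => hψ₂ i (by omega))
      (fun g h i j hi hj => by
        have := hmul g h i j (by omega) (by omega)
        rwa [Finset.sum_range_succ, htri h d j hj, mul_zero, add_zero] at this)
      (fun g i hi => hdiag g i (by omega)) (fun k hk => hwound k (by omega))
    have hred : ∀ {x y : ZMod (p ^ (r + 1))}, (p : ZMod (p ^ (r + 1))) ^ r ∣ x - y →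
        reductionModP p r x = reductionModP p r y := fun {x y} h => by
      rw [← sub_eq_zero, ← map_sub, reductionModP_eq_zero_iff]
      exact (dvd_pow_self _ (by omega)).trans h
    have hinv : ∀ g, ((ψ d g)⁻¹ : (ZMod (p ^ (r + 1)))ˣ) * (ψ d g : ZMod (p ^ (r + 1))) = 1 :=
      fun g => Units.inv_mul _
    -- This is the action on `Hom(L, V)`, with `L` the new top line and `V` the lifted block.
    -- Extensions of `L` by `V` are cocycles with values in it.
    let B : Γ →* Matrix (Fin d) (Fin d) (ZMod (p ^ (r + 1))) :=
      { toFun := fun g => (((ψ d g)⁻¹ : (ZMod (p ^ (r + 1)))ˣ) : ZMod (p ^ (r + 1))) • A' g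
        map_one' := by simp
        map_mul' := fun g h => by
          simp [smul_smul, mul_comm] }
    have hBA : ∀ g i j, B g i j =
        (((ψ d g)⁻¹ : (ZMod (p ^ (r + 1)))ˣ) : ZMod (p ^ (r + 1))) * A' g i j := fun g i j => rfl
    let b : Γ → Fin d → ZMod (p ^ (r + 1)) := fun g i =>
      (((ψ d g)⁻¹ : (ZMod (p ^ (r + 1)))ˣ) : ZMod (p ^ (r + 1))) * A g i d
    obtain ⟨b', hb', hb'b, hb'0⟩ := exists_wound_cocycle_lift hP₁ hP₂ χ hχ hcup B
      (((hψ d (by omega)).prodMk hA').comp (fun y =>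
        ((y.1⁻¹ : (ZMod (p ^ (r + 1)))ˣ) : ZMod (p ^ (r + 1))) • y.2))
      (fun g i j hij => by rw [hBA, htri' g i j hij, mul_zero])
      (fun x hx i hi => by
        rw [hBA, hdiag', hψ₁ i (by omega) x hx, hi, Units.val_mul, mul_left_comm, hinv, mul_one])
      (fun x hx i => by
        have h1 := congrArg (reductionModP p r) (hinv x)
        rw [map_mul, hψ₂ d (by omega) x hx, mul_one, map_one] at h1
        rw [hBA, hdiag', map_mul, h1, hψ₂ i (by omega) x hx, one_mul])
      (fun k' k hk => by
        rintro ⟨m, hm⟩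
        refine hwound k' (by omega) ⟨m, fun g => ?_⟩
        have h1 := congrArg (reductionModP p r) (hinv g)
        rw [map_mul, map_one] at h1
        have h2 := hm g
        rw [hBA, hBA, hBA, hdiag', hdiag', map_mul, map_mul, map_mul, hred (hA'A g k' k),
          ← hk] at h2
        have h3 : reductionModP p r (ψ d g) * (reductionModP p r ((ψ d g)⁻¹ : (ZMod (p ^ (r + 1)))ˣ)
            * reductionModP p r (A g k' (k' + 1))) = _ := congrArg _ h2
        linear_combination h3 - (reductionModP p r (A g k' (k' + 1)) - m *
          (reductionModP p r (ψ (k' + 1) g) - reductionModP p r (ψ k' g))) * h1)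
      b (((hψ d (by omega)).prodMk hA).comp (fun y => fun i : Fin d =>
        ((y.1⁻¹ : (ZMod (p ^ (r + 1)))ˣ) : ZMod (p ^ (r + 1))) * y.2 i d))
      (fun g h i => by
        have h1 := hmul g h i d (by omega) (by omega)
        rw [Finset.sum_range_succ, ← Fin.sum_univ_eq_sum_range (fun k => A g i k * A h k d)] at h1
        -- Replacing `A` by `A'` in the block and by `ψ d` in the corner changes the product only by
        -- multiples of `p^r`, so `b` is a cocycle modulo `p^r` for the new action.
        have h2 : (p : ZMod (p ^ (r + 1))) ^ r ∣
            ∑ k : Fin d, A' g i k * A h k d - ∑ k : Fin d, A g i k * A h k d := by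
          rw [← Finset.sum_sub_distrib]
          refine Finset.dvd_sum fun k _ => ?_
          rw [← sub_mul]
          exact (hA'A g i k).mul_right _
        have h3 := (hdiag h d (by omega)).mul_left (A g i d)
        have h4 := ((h2.sub h1).sub h3).mul_left
          ((((ψ d g)⁻¹ : (ZMod (p ^ (r + 1)))ˣ) : ZMod (p ^ (r + 1))) *
            (((ψ d h)⁻¹ : (ZMod (p ^ (r + 1)))ˣ) : ZMod (p ^ (r + 1))))
        convert h4 using 1
        have h5 : (B g).mulVec (b h) i =
            (((ψ d g)⁻¹ : (ZMod (p ^ (r + 1)))ˣ) : ZMod (p ^ (r + 1))) *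
            (((ψ d h)⁻¹ : (ZMod (p ^ (r + 1)))ˣ) : ZMod (p ^ (r + 1))) *
              ∑ k : Fin d, A' g i k * A h k d := by
          rw [Finset.mul_sum, Matrix.mulVec, dotProduct]
          refine Finset.sum_congr rfl fun k _ => ?_
          simp only [hBA, b]
          ring
        have h6 : b (g * h) i = (((ψ d g)⁻¹ : (ZMod (p ^ (r + 1)))ˣ) : ZMod (p ^ (r + 1))) *
            (((ψ d h)⁻¹ : (ZMod (p ^ (r + 1)))ˣ) : ZMod (p ^ (r + 1))) * A (g * h) i d := by
          simp only [b, map_mul, mul_inv, Units.val_mul]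
        simp only [cocycleDefect, Pi.add_apply, Pi.sub_apply, h5, h6]
        simp only [b]
        linear_combination -(((ψ d g)⁻¹ : (ZMod (p ^ (r + 1)))ˣ) : ZMod (p ^ (r + 1))) *
          A g i d * hinv h)
    -- The block matrix with `A'` and `ψ d` on the diagonal; the last column is the lifted cocycle
    -- multiplied back by `ψ d`.
    let C : Γ → Matrix (Fin (d + 1)) (Fin (d + 1)) (ZMod (p ^ (r + 1))) := fun g i j =>
      Fin.lastCases (motive := fun _ => ZMod (p ^ (r + 1)))
        (Fin.lastCases (motive := fun _ => ZMod (p ^ (r + 1)))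
          (ψ d g : ZMod (p ^ (r + 1))) (fun i => b' g i * ψ d g) i)
        (fun j => Fin.lastCases (motive := fun _ => ZMod (p ^ (r + 1))) 0 (fun i => A' g i j) i) j
    have hC1 : ∀ g i j, C g (Fin.castSucc i) (Fin.castSucc j) = A' g i j := fun g i j => by simp [C]
    have hC2 : ∀ g i, C g (Fin.castSucc i) (Fin.last d) = b' g i * ψ d g := fun g i => by simp [C]
    have hC3 : ∀ g j, C g (Fin.last d) (Fin.castSucc j) = 0 := fun g j => by simp [C]
    have hC4 : ∀ g, C g (Fin.last d) (Fin.last d) = ψ d g := fun g => by simp [C]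
    have hb'mul : ∀ g h i, b' (g * h) i = b' g i + ∑ j, B g i j * b' h j := fun g h i =>
      (sub_eq_zero.1 (hb'0 g h i)).symm
    refine ⟨⟨⟨C, ?_⟩, ?_⟩, ?_, ?_, ?_, ?_⟩
    · have h1 : ∀ i, b' 1 i = 0 := fun i => by
        have := hb'mul 1 1 i
        simpa [Matrix.one_apply] using this
      ext i j
      refine Fin.lastCases ?_ (fun i => ?_) i <;> refine Fin.lastCases ?_ (fun j => ?_) j
      · rw [hC4]; simp
      · rw [hC3, Matrix.one_apply_ne (Fin.castSucc_lt_last j).ne']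
      · rw [hC2, Matrix.one_apply_ne (Fin.castSucc_lt_last i).ne, h1, zero_mul]
      · rw [hC1, map_one]; simp [Matrix.one_apply]
    · intro g h
      ext i j
      rw [Matrix.mul_apply, Fin.sum_univ_castSucc]
      refine Fin.lastCases ?_ (fun i => ?_) i <;> refine Fin.lastCases ?_ (fun j => ?_) j
      · simp only [hC4, hC3, hC2, map_mul, Units.val_mul, zero_mul, Finset.sum_const_zero, zero_add]
      · simp only [hC3, zero_mul, mul_zero, Finset.sum_const_zero, zero_add]
      · simp only [hC2, hC1, hC4, hb'mul, hBA, map_mul, Units.val_mul]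
        rw [add_mul, Finset.sum_mul, add_comm (b' g i * _)]
        congr 1
        · refine Finset.sum_congr rfl fun k _ => ?_
          linear_combination A' g i k * b' h k * ψ d h * hinv g
        · ring
      · simp only [hC1, hC3, mul_zero, add_zero, map_mul, Matrix.mul_apply]
    · exact ((hA'.prodMk hb').prodMk (hψ d (by omega))).comp (fun y => fun i j =>
        Fin.lastCases (motive := fun _ => ZMod (p ^ (r + 1)))
        (Fin.lastCases (motive := fun _ => ZMod (p ^ (r + 1)))
          (y.2 : ZMod (p ^ (r + 1))) (fun i => y.1.2 i * (y.2 : ZMod (p ^ (r + 1)))) i)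
        (fun j => Fin.lastCases (motive := fun _ => ZMod (p ^ (r + 1))) 0 (fun i => y.1.1 i j) i) j)
    · intro g i j
      change j < i → C g i j = 0
      refine Fin.lastCases ?_ (fun i => ?_) i <;> refine Fin.lastCases ?_ (fun j => ?_) j
      · exact fun h => absurd h (lt_irrefl _)
      · exact fun _ => hC3 g j
      · exact fun h => absurd h (Fin.castSucc_lt_last i).not_gt
      · exact fun h => (hC1 g i j).trans (htri' g i j (by simpa using h))
    · intro g i
      change C g i i = ψ i g
      refine Fin.lastCases ?_ (fun i => ?_) i
      · exact hC4 g
      · rw [hC1, hdiag']; rfl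
    · intro g i j
      change _ ∣ C g i j - A g i j
      refine Fin.lastCases ?_ (fun i => ?_) i <;> refine Fin.lastCases ?_ (fun j => ?_) j
      · rw [hC4, Fin.val_last, ← neg_sub, dvd_neg]
        exact hdiag g d (by omega)
      · rw [hC3, Fin.val_last, Fin.val_castSucc, htri g d j j.2, sub_zero]
        exact dvd_zero _
      · rw [hC2, Fin.val_last, Fin.val_castSucc]
        have h1 := (hb'b g i).mul_right (ψ d g : ZMod (p ^ (r + 1)))
        convert h1 using 1
        linear_combination A g i d * hinv g
      · rw [hC1]
        exact hA'A g i j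

end Core

/-! ## Flags with an adapted basis -/

namespace FiltRep

variable {n d : ℕ} {Γ : Type v} [Group Γ]

/-- A basis `b_0, …, b_{d-1}` such that `V_i` is spanned by the `b_j` with `j < i`. -/
structure AdaptedBasis (F : FiltRep.{u} n Γ) (d : ℕ) where
  /-- the underlying basis -/
  basis : Module.Basis (Fin d) (ZMod n) F.carrier
  mem_fil : ∀ i v, v ∈ F.fil i ↔ ∀ j : Fin d, i ≤ j → basis.repr v j = 0

namespace AdaptedBasis

variable {F : FiltRep.{u} n Γ} (b : F.AdaptedBasis d)

/-- The matrices of the action in an adapted basis. -/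
noncomputable def mat : Γ →* Matrix (Fin d) (Fin d) (ZMod n) :=
  (LinearMap.toMatrixAlgEquiv b.basis).toMonoidHom.comp F.rep

theorem mat_apply (g : Γ) (i j : Fin d) : b.mat g i j = b.basis.repr (F.rep g (b.basis j)) i :=
  LinearMap.toMatrixAlgEquiv_apply _ _ _ _

theorem repr_rep (g : Γ) (v : F.carrier) (i : Fin d) :
    b.basis.repr (F.rep g v) i = ∑ j, b.mat g i j * b.basis.repr v j := by
  exact (congrFun (LinearMap.toMatrix_mulVec_repr b.basis b.basis (F.rep g) v) i).symm

theorem basis_mem_fil {i : ℕ} {j : Fin d} (h : (j : ℕ) < i) : b.basis j ∈ F.fil i := by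
  rw [b.mem_fil]
  intro k hk
  rw [b.basis.repr_self, Finsupp.single_eq_of_ne]
  rintro rfl
  omega

theorem mat_eq_zero (g : Γ) (i j : Fin d) (h : j < i) : b.mat g i j = 0 := by
  rw [mat_apply]
  exact (b.mem_fil (j + 1) _).1 (F.fil_stable _ g (b.basis_mem_fil (Nat.lt_succ_self _))) i h

theorem fil_eq_top (b : F.AdaptedBasis d) {i : ℕ} (h : d ≤ i) : F.fil i = ⊤ := by
  rw [eq_top_iff]
  intro v _
  rw [b.mem_fil]
  intro j hj
  have := j.2
  omega

/-- Flags with adapted bases in which the matrices of the action agree are isomorphic. -/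
theorem iso {F' : FiltRep.{u} n Γ} (b' : F'.AdaptedBasis d) (h : ∀ g, b.mat g = b'.mat g) :
    F.Iso F' := by
  let e := b.basis.equiv b'.basis (Equiv.refl _)
  have he : ∀ v i, b'.basis.repr (e v) i = b.basis.repr v i := fun v i => by
    simp [e, Module.Basis.equiv]
  refine ⟨Representation.Equiv.mk e fun g => LinearMap.ext fun v => ?_, fun i => ?_⟩
  · refine b'.basis.ext_elem fun i => ?_
    change b'.basis.repr (e (F.rep g v)) i = b'.basis.repr (F'.rep g (e v)) i
    rw [he, b.repr_rep, b'.repr_rep, h]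
    simp only [he]
  · ext v
    constructor
    · rintro ⟨w, hw, rfl⟩
      rw [b'.mem_fil]
      intro j hj
      exact (he w j).trans ((b.mem_fil i w).1 hw j hj)
    · intro hv
      refine ⟨e.symm v, (b.mem_fil i _).2 fun j hj => ?_, e.apply_symm_apply v⟩
      rw [← he, e.apply_symm_apply]
      exact (b'.mem_fil i v).1 hv j hj

/-- The coordinates on `V_i`. -/
noncomputable def filEquiv {i : ℕ} (hi : i ≤ d) : F.fil i ≃ₗ[ZMod n] (Fin i → ZMod n) :=
  LinearEquiv.ofBijective
    (LinearMap.pi fun j : Fin i => (b.basis.coord (Fin.castLE hi j)).comp (F.fil i).subtype) (by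
      constructor
      · rw [← LinearMap.ker_eq_bot, LinearMap.ker_eq_bot']
        intro v hv
        refine Subtype.ext (b.basis.ext_elem fun j => ?_)
        by_cases hj : (j : ℕ) < i
        · simpa using congrFun hv ⟨j, hj⟩
        · simpa using (b.mem_fil i v).1 v.2 j (by omega)
      · intro c
        refine ⟨⟨b.basis.equivFun.symm fun j => if h : (j : ℕ) < i then c ⟨j, h⟩ else 0, ?_⟩, ?_⟩
        · rw [b.mem_fil]
          intro j hj
          rw [← b.basis.equivFun_apply, LinearEquiv.apply_symm_apply]
          simp [hj]
        · funext j
          change b.basis.repr (b.basis.equivFun.symm _) (Fin.castLE hi j) = c j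
          rw [← b.basis.equivFun_apply, LinearEquiv.apply_symm_apply]
          simp)

theorem isCompleteFlag [Nontrivial (ZMod n)] [TopologicalSpace Γ]
    (hb : IsLocallyConstant b.mat) : F.IsCompleteFlag d where
  continuous_action := by
    refine ⟨b.mat.ker, inferInstance, hb.isOpen_fiber 1, fun g hg => ?_⟩
    exact (LinearMap.toMatrixAlgEquiv b.basis).injective
      ((MonoidHom.mem_ker.1 hg).trans (map_one _).symm)
  finite := Module.Finite.of_basis b.basis
  fil_zero := by
    rw [eq_bot_iff]
    intro v hv
    rw [b.mem_fil] at hv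
    exact b.basis.ext_elem fun i => by simpa using hv i (Nat.zero_le _)
  fil_top := b.fil_eq_top le_rfl
  free i hi := Module.Free.of_equiv (b.filEquiv hi).symm
  finrank i hi := by
    rw [(b.filEquiv hi).finrank_eq, Module.finrank_fin_fun]

/-- The coordinate on the line `V_{k+1} / V_k`. -/
noncomputable def lineEquiv (k : Fin d) : F.quo k (k + 1) ≃ₗ[ZMod n] ZMod n :=
  LinearEquiv.ofBijective
    (Submodule.liftQ _ ((b.basis.coord k).comp (F.fil (k + 1)).subtype)
      (fun v hv => (b.mem_fil k v).1 hv k le_rfl)) (by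
      constructor
      · rw [← LinearMap.ker_eq_bot, LinearMap.ker_eq_bot']
        intro x hx
        obtain ⟨v, rfl⟩ := Submodule.Quotient.mk_surjective _ x
        refine (Submodule.Quotient.mk_eq_zero _).2 ((b.mem_fil k v).2 fun j hj => ?_)
        rcases hj.eq_or_lt with h | h
        · obtain rfl := Fin.ext h
          exact hx
        · exact (b.mem_fil (k + 1) v).1 v.2 j h
      · intro c
        refine ⟨Submodule.Quotient.mk ⟨c • b.basis k,
          Submodule.smul_mem _ _ (b.basis_mem_fil (Nat.lt_succ_self _))⟩, ?_⟩
        change b.basis.repr (c • b.basis k) k = c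
        simp)

theorem lineEquiv_rep (k : Fin d) (g : Γ) (x : F.quo k (k + 1)) :
    b.lineEquiv k (F.quoRep k (k + 1) g x) = b.mat g k k * b.lineEquiv k x := by
  obtain ⟨v, rfl⟩ := Submodule.Quotient.mk_surjective _ x
  change b.basis.repr (F.rep g v) k = b.mat g k k * b.basis.repr v k
  rw [b.repr_rep, Finset.sum_eq_single k]
  · intro j _ hj
    rcases lt_or_gt_of_ne hj with h | h
    · rw [b.mat_eq_zero g k j h, zero_mul]
    · rw [(b.mem_fil (k + 1) v).1 v.2 j h, mul_zero]
  · simp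

theorem lineChar_twist_quoRep [Nontrivial (ZMod n)] (ψ : Γ →* (ZMod n)ˣ) (m : ℤ) (k : Fin d)
    (g : Γ) : (lineChar (twist ψ m (F.quoRep k (k + 1))) g : ZMod n) =
      ((ψ g ^ m : (ZMod n)ˣ) : ZMod n) * b.mat g k k := by
  have h : F.quoRep k (k + 1) g = b.mat g k k • LinearMap.id := LinearMap.ext fun x =>
    (b.lineEquiv k).injective (by simp [lineEquiv_rep])
  change LinearMap.det (((ψ g ^ m : (ZMod n)ˣ) : ZMod n) • F.quoRep k (k + 1) g) = _
  have : Module.Free (ZMod n) (F.quo k (k + 1)) := Module.Free.of_equiv (b.lineEquiv k).symm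
  rw [h, smul_smul, LinearMap.det_smul, LinearMap.det_id, (b.lineEquiv k).finrank_eq,
    Module.finrank_self, pow_one, mul_one]

/-- Scalars commute with every linear isomorphism, so isomorphic rank one representations have equal
characters. The Kummer condition thus becomes an equality of diagonal entries. -/
theorem nonempty_equiv_iff (k : Fin d) (σ : Representation (ZMod n) Γ (ZMod n)) (c : Γ → ZMod n)
    (hσ : ∀ g x, σ g x = c g * x) :
    Nonempty ((F.quoRep k (k + 1)).Equiv σ) ↔ ∀ g, b.mat g k k = c g := by
  constructor
  · rintro ⟨f⟩ g
    let e : ZMod n ≃ₗ[ZMod n] ZMod n := (b.lineEquiv k).symm.trans f.toLinearEquiv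
    have h1 : ∀ x, e (b.mat g k k * x) = c g * e x := fun x => by
      have h2 := f.toIntertwiningMap.isIntertwining _ _ g ((b.lineEquiv k).symm x)
      rw [hσ] at h2
      have h3 : F.quoRep k (k + 1) g ((b.lineEquiv k).symm x) =
          (b.lineEquiv k).symm (b.mat g k k * x) := by
        rw [LinearEquiv.eq_symm_apply, b.lineEquiv_rep, LinearEquiv.apply_symm_apply]
      rw [h3] at h2
      exact h2
    have h4 := h1 (e.symm 1)
    rw [LinearEquiv.apply_symm_apply, ← smul_eq_mul, map_smul, LinearEquiv.apply_symm_apply,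
      smul_eq_mul, mul_one, mul_one] at h4
    exact h4
  · intro h
    refine ⟨Representation.Equiv.mk (b.lineEquiv k) fun g => LinearMap.ext fun x => ?_⟩
    change b.lineEquiv k (F.quoRep k (k + 1) g x) = σ g (b.lineEquiv k x)
    rw [b.lineEquiv_rep, hσ, h]

/-- A splitting amounts to a vector `b_{k+1} + m b_k` on which every `g` acts, modulo `V_k`, by the
lower diagonal entry. Comparing coefficients of `b_k` gives the equation. -/
theorem extSplits_iff (k : ℕ) (hk : k + 1 < d) (h : k ≤ k + 1) :
    F.ExtSplits h (k + 2) ↔ ∃ m, ∀ g, b.mat g ⟨k, by omega⟩ ⟨k + 1, hk⟩ =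
      m * (b.mat g ⟨k + 1, hk⟩ ⟨k + 1, hk⟩ - b.mat g ⟨k, by omega⟩ ⟨k, by omega⟩) := by
  set k₀ : Fin d := ⟨k, by omega⟩ with hk₀
  set k₁ : Fin d := ⟨k + 1, hk⟩ with hk₁
  have hne : k₀ ≠ k₁ := by simp [hk₀, hk₁]
  have hrepr : ∀ v ∈ F.fil (k + 2), ∀ g, b.basis.repr (F.rep g v) k₀ =
      b.mat g k₀ k₀ * b.basis.repr v k₀ + b.mat g k₀ k₁ * b.basis.repr v k₁ := by
    intro v hv g
    rw [b.repr_rep, Finset.sum_eq_add k₀ k₁ hne]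
    · rintro j - ⟨h0, h1⟩
      rcases lt_or_gt_of_ne h0 with h2 | h2
      · rw [b.mat_eq_zero g k₀ j h2, zero_mul]
      · rw [(b.mem_fil (k + 2) v).1 hv j, mul_zero]
        have h3 : (j : ℕ) ≠ k + 1 := fun h4 => h1 (Fin.ext h4)
        have h4 : k < (j : ℕ) := h2
        omega
    all_goals simp
  constructor
  · rintro ⟨s, hs⟩
    obtain ⟨x, hx⟩ := (b.lineEquiv k₁).surjective 1
    obtain ⟨v, hv⟩ := Submodule.Quotient.mk_surjective _ (s x)
    have h1 : b.basis.repr v k₁ = 1 := by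
      have h2 : F.quoProj h (k + 2) (Submodule.Quotient.mk v) = x := by
        rw [hv]
        exact LinearMap.congr_fun hs x
      rw [← hx, ← h2]
      rfl
    refine ⟨b.basis.repr v k₀, fun g => ?_⟩
    have h3 : F.quoRep (k + 1) (k + 2) g x = b.mat g k₁ k₁ • x :=
      (b.lineEquiv k₁).injective (by
        rw [map_smul, smul_eq_mul]
        exact b.lineEquiv_rep k₁ g x)
    have h4 : F.quoRep k (k + 2) g (s x) = b.mat g k₁ k₁ • s x := by
      exact (s.isIntertwining _ _ g x).symm.trans ((congrArg s h3).trans (map_smul s _ _))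
    rw [← hv, ← Submodule.Quotient.mk_smul] at h4
    have h5 := (b.mem_fil k _).1 ((Submodule.Quotient.eq ((F.fil k).submoduleOf (F.fil (k + 2)))).1 h4) k₀ le_rfl
    have h6 : b.basis.repr (F.rep g v - b.mat g k₁ k₁ • (v : F.carrier)) k₀ = 0 := h5
    rw [map_sub, map_smul, Finsupp.sub_apply, Finsupp.smul_apply, hrepr v v.2, h1,
      smul_eq_mul] at h6
    linear_combination h6
  · rintro ⟨m, hm⟩
    let w : F.carrier := b.basis k₁ + m • b.basis k₀
    have hw : w ∈ F.fil (k + 2) := Submodule.add_mem _ (b.basis_mem_fil (Nat.lt_succ_self _))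
      (Submodule.smul_mem _ _ (b.basis_mem_fil (Nat.lt_succ_of_lt (Nat.lt_succ_self _))))
    have hw0 : b.basis.repr w k₀ = m := by simp [w, hne]
    have hw1 : b.basis.repr w k₁ = 1 := by simp [w, hne]
    let w' : F.quo k (k + 2) := Submodule.Quotient.mk ⟨w, hw⟩
    have hgw : ∀ g, F.quoRep k (k + 2) g w' = b.mat g k₁ k₁ • w' := fun g => by
      refine (Submodule.Quotient.eq _).2 ((b.mem_fil k _).2 fun j hj => ?_)
      change b.basis.repr (F.rep g w - b.mat g k₁ k₁ • w) j = 0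
      rw [map_sub, map_smul, Finsupp.sub_apply, Finsupp.smul_apply, smul_eq_mul]
      rcases hj.eq_or_lt with h0 | h0
      · obtain rfl : k₀ = j := Fin.ext h0
        rw [hrepr w hw, hw0, hw1]
        linear_combination hm g
      · rcases (Nat.succ_le_of_lt h0).eq_or_lt with h2 | h2
        · obtain rfl : k₁ = j := Fin.ext h2
          have h3 : b.basis.repr (F.rep g w) k₁ = b.mat g k₁ k₁ * b.basis.repr w k₁ :=
            b.lineEquiv_rep k₁ g (Submodule.Quotient.mk ⟨w, hw⟩)
          rw [h3, sub_self]
        · rw [(b.mem_fil (k + 2) _).1 (F.fil_stable _ g hw) j h2,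
            (b.mem_fil (k + 2) _).1 hw j h2, mul_zero, sub_zero]
    refine ⟨⟨((b.lineEquiv k₁).toLinearMap).smulRight w', fun g => LinearMap.ext fun x => ?_⟩, ?_⟩
    · change b.lineEquiv k₁ (F.quoRep (k + 1) (k + 2) g x) • w' =
        F.quoRep k (k + 2) g (b.lineEquiv k₁ x • w')
      rw [map_smul, hgw, smul_smul, mul_comm]
      exact congrArg (· • w') (b.lineEquiv_rep k₁ g x)
    · refine LinearMap.ext fun x => (b.lineEquiv k₁).injective ?_
      change b.lineEquiv k₁ (F.quoProj h (k + 2) (b.lineEquiv k₁ x • w')) = b.lineEquiv k₁ x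
      rw [map_smul, map_smul, smul_eq_mul]
      have : b.lineEquiv k₁ (F.quoProj h (k + 2) w') = 1 := hw1
      rw [this, mul_one]

/-! ### Reduction of adapted bases -/

section Reduce

variable {m : ℕ} (hmn : m ∣ n)

theorem redMap_eq_zero_iff (v : F.carrier) :
    F.redMap m v = 0 ↔ ∀ j, ZMod.castHom hmn (ZMod m) (b.basis.repr v j) = 0 := by
  constructor
  · intro h j
    obtain ⟨w, rfl⟩ := (Submodule.Quotient.mk_eq_zero _).1 h
    rw [LinearMap.smul_apply, LinearMap.id_apply, map_nsmul, Finsupp.smul_apply, map_nsmul,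
      nsmul_eq_mul, ZMod.natCast_self, zero_mul]
  · intro h
    have h1 : ∀ j, ∃ y : ZMod n, b.basis.repr v j = m * y := fun j => by
      obtain ⟨z, hz⟩ := ZMod.intCast_surjective (b.basis.repr v j)
      have h2 := h j
      rw [← hz, map_intCast, ZMod.intCast_zmod_eq_zero_iff_dvd] at h2
      obtain ⟨y, hy⟩ := h2
      exact ⟨y, by rw [← hz, hy]; push_cast; rfl⟩
    choose y hy using h1
    refine (Submodule.Quotient.mk_eq_zero _).2 ⟨b.basis.equivFun.symm y, ?_⟩
    refine b.basis.ext_elem fun j => ?_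
    rw [LinearMap.smul_apply, LinearMap.id_apply, map_nsmul, Finsupp.smul_apply,
      ← b.basis.equivFun_apply, LinearEquiv.apply_symm_apply, hy, nsmul_eq_mul]

/-- The coordinates on the reduction modulo `m`. -/
noncomputable def redCoord : F.Red m →+ (Fin d → ZMod m) :=
  (F.redMap m).liftOfSurjective (F.redMap_surjective m)
    ⟨AddMonoidHom.pi fun j => ((ZMod.castHom hmn (ZMod m)).toAddMonoidHom.comp
      (b.basis.coord j).toAddMonoidHom),
    fun v hv => funext fun j => (b.redMap_eq_zero_iff hmn v).1 hv j⟩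

theorem redCoord_redMap (v : F.carrier) (j : Fin d) :
    b.redCoord hmn (F.redMap m v) j = ZMod.castHom hmn (ZMod m) (b.basis.repr v j) := by
  rw [redCoord, AddMonoidHom.liftOfSurjective, AddMonoidHom.liftOfRightInverse_comp_apply]
  rfl

/-- The coordinates on the reduction modulo `m`, as a linear equivalence. -/
noncomputable def redEquiv : F.Red m ≃ₗ[ZMod m] (Fin d → ZMod m) :=
  LinearEquiv.ofBijective (AddMonoidHom.toZModLinearMap m (b.redCoord hmn)) (by
    constructor
    · rw [← LinearMap.ker_eq_bot, LinearMap.ker_eq_bot']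
      intro x hx
      obtain ⟨v, rfl⟩ := F.redMap_surjective m x
      exact (b.redMap_eq_zero_iff hmn v).2 fun j =>
        (b.redCoord_redMap hmn v j).symm.trans (congrFun hx j)
    · intro c
      choose y hy using fun j => ZMod.ringHom_surjective (ZMod.castHom hmn (ZMod m)) (c j)
      refine ⟨F.redMap m (b.basis.equivFun.symm y), funext fun j => ?_⟩
      refine (b.redCoord_redMap hmn _ j).trans ?_
      rw [← b.basis.equivFun_apply, LinearEquiv.apply_symm_apply, hy])

/-- The reduction of an adapted basis. -/
noncomputable def reduce : (F.reduce m).AdaptedBasis d where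
  basis := Module.Basis.ofEquivFun (b.redEquiv hmn)
  mem_fil i x := by
    obtain ⟨v, rfl⟩ := F.redMap_surjective m x
    have h1 : ∀ j, (Module.Basis.ofEquivFun (b.redEquiv hmn)).repr (F.redMap m v) j =
        ZMod.castHom hmn (ZMod m) (b.basis.repr v j) := fun j => b.redCoord_redMap hmn v j
    change (∃ w ∈ F.fil i, F.redMap m w = F.redMap m v) ↔ ∀ j : Fin d, i ≤ j →
      (Module.Basis.ofEquivFun (b.redEquiv hmn)).repr (F.redMap m v) j = 0
    simp only [h1]
    constructor
    · rintro ⟨w, hw, hwv⟩ j hj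
      rw [← redCoord_redMap, ← hwv, redCoord_redMap, (b.mem_fil i w).1 hw j hj, map_zero]
    · intro h
      have h2 : ∀ j : Fin d, b.basis.repr (b.basis.equivFun.symm fun j : Fin d =>
          if (j : ℕ) < i then b.basis.repr v j else 0) j =
          if (j : ℕ) < i then b.basis.repr v j else 0 := fun j => by
        rw [← b.basis.equivFun_apply, LinearEquiv.apply_symm_apply]
      refine ⟨_, (b.mem_fil i _).2 fun j hj => (h2 j).trans (if_neg (by omega)), ?_⟩
      rw [← sub_eq_zero, ← map_sub, b.redMap_eq_zero_iff hmn]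
      intro j
      rw [map_sub, Finsupp.sub_apply, h2]
      split_ifs with hj
      · rw [sub_self, map_zero]
      · rw [map_sub, map_zero, h j (by omega), sub_zero]

theorem mat_reduce (g : Γ) (i j : Fin d) :
    (b.reduce hmn).mat g i j = ZMod.castHom hmn (ZMod m) (b.mat g i j) := by
  have h1 : (b.reduce hmn).basis j = F.redMap m (b.basis j) := by
    refine (b.reduce hmn).basis.ext_elem fun k => ?_
    have h2 : (b.reduce hmn).basis.repr (F.redMap m (b.basis j)) k =
        ZMod.castHom hmn (ZMod m) (b.basis.repr (b.basis j) k) := b.redCoord_redMap hmn _ k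
    rw [h2, Module.Basis.repr_self, Module.Basis.repr_self]
    by_cases h : k = j
    · rw [h, Finsupp.single_eq_same, Finsupp.single_eq_same, map_one]
    · simp [h]
  rw [mat_apply, mat_apply, h1]
  exact b.redCoord_redMap hmn (F.rep g (b.basis j)) i

end Reduce

end AdaptedBasis

/-- A complete flag whose graded pieces are free of rank one has an adapted basis. -/
theorem IsCompleteFlag.nonempty_adaptedBasis [TopologicalSpace Γ] [Nontrivial (ZMod n)]
    {F : FiltRep.{u} n Γ} (hF : F.IsCompleteFlag d)
    (hline : ∀ k < d, Nonempty (F.quo k (k + 1) ≃ₗ[ZMod n] ZMod n)) :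
    Nonempty (F.AdaptedBasis d) := by
  have h1 : ∀ k : Fin d, ∃ v ∈ F.fil (k + 1), ∀ x ∈ F.fil (k + 1), ∃ t : ZMod n,
      x - t • v ∈ F.fil k := fun k => by
    obtain ⟨e⟩ := hline k k.2
    obtain ⟨v, hv⟩ := Submodule.Quotient.mk_surjective _ (e.symm 1)
    refine ⟨v, v.2, fun x hx => ⟨e (Submodule.Quotient.mk ⟨x, hx⟩), ?_⟩⟩
    refine (Submodule.Quotient.eq ((F.fil k).submoduleOf (F.fil (k + 1)))
      (x := ⟨x, hx⟩) (y := e (Submodule.Quotient.mk ⟨x, hx⟩) • v)).1 ?_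
    rw [Submodule.Quotient.mk_smul, hv, ← map_smul, smul_eq_mul, mul_one,
      LinearEquiv.symm_apply_apply]
  choose v hv hvx using h1
  have h2 : ∀ k ≤ d, ∀ x ∈ F.fil k, ∃ c : Fin d → ZMod n, (∀ j : Fin d, k ≤ j → c j = 0) ∧
      Fintype.linearCombination (ZMod n) v c = x := by
    intro k
    induction k with
    | zero =>
      intro _ x hx
      rw [hF.fil_zero, Submodule.mem_bot] at hx
      exact ⟨0, by simp, by simp [hx]⟩
    | succ k ih =>
      intro hk x hx
      obtain ⟨t, ht⟩ := hvx ⟨k, hk⟩ x hx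
      obtain ⟨c, hc, hcx⟩ := ih (by omega) _ ht
      refine ⟨c + Pi.single ⟨k, hk⟩ t, fun j hj => ?_, ?_⟩
      · have : j ≠ ⟨k, hk⟩ := by rintro rfl; simp at hj
        simp [hc j (by omega), this]
      · rw [map_add, hcx, Fintype.linearCombination_apply_single, sub_add_cancel]
  let f : (Fin d → ZMod n) →ₗ[ZMod n] F.carrier := Fintype.linearCombination (ZMod n) v
  have hfs : Function.Surjective f := fun x => by
    obtain ⟨c, -, hc⟩ := h2 d le_rfl x (hF.fil_top ▸ Submodule.mem_top)
    exact ⟨c, hc⟩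
  have hfree := hF.free d le_rfl
  have hrank := hF.finrank d le_rfl
  have hfin := hF.finite
  rw [hF.fil_top] at hfree hrank
  have hfree' : Module.Free (ZMod n) F.carrier := Module.Free.of_equiv Submodule.topEquiv
  rw [Submodule.topEquiv.finrank_eq] at hrank
  let e : F.carrier ≃ₗ[ZMod n] (Fin d → ZMod n) :=
    (Module.finBasisOfFinrankEq (ZMod n) F.carrier hrank).equivFun
  have hfi : Function.Injective f := by
    -- A spanning family whose size is the rank is a basis: a surjective endomorphism of a finite
    -- free module is injective.
    have := OrzechProperty.injective_of_surjective_endomorphism (e.toLinearMap.comp f)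
      (e.surjective.comp hfs)
    exact Function.Injective.of_comp (f := e) this
  let E := LinearEquiv.ofBijective f ⟨hfi, hfs⟩
  refine ⟨⟨Module.Basis.ofEquivFun E.symm, fun i x => ?_⟩⟩
  change x ∈ F.fil i ↔ ∀ j : Fin d, i ≤ j → E.symm x j = 0
  constructor
  · intro hx j hj
    obtain ⟨c, hc, hcx⟩ := h2 i (by omega) x hx
    have : E.symm x = c := by rw [LinearEquiv.symm_apply_eq]; exact hcx.symm
    rw [this, hc j hj]
  · intro h
    rw [← E.apply_symm_apply x]
    change Fintype.linearCombination (ZMod n) v (E.symm x) ∈ F.fil i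
    rw [Fintype.linearCombination_apply]
    refine Submodule.sum_mem _ fun j _ => ?_
    by_cases hj : i ≤ j
    · rw [h j hj, zero_smul]
      exact Submodule.zero_mem _
    · exact Submodule.smul_mem _ _ (F.fil_mono (by omega) (hv j))

/-- The flag attached to a homomorphism to upper triangular matrices. -/
theorem exists_adaptedBasis_of_matrix (A : Γ →* Matrix (Fin d) (Fin d) (ZMod n))
    (hA : ∀ g i j, j < i → A g i j = 0) :
    ∃ (F : FiltRep.{u} n Γ) (b : F.AdaptedBasis d), b.mat = A := by
  let B : Module.Basis (Fin d) (ZMod n) (ULift.{u} (Fin d → ZMod n)) :=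
    (Pi.basisFun (ZMod n) (Fin d)).map ULift.moduleEquiv.symm
  let ρ : Representation (ZMod n) Γ (ULift.{u} (Fin d → ZMod n)) :=
    (LinearMap.toMatrixAlgEquiv B).symm.toMonoidHom.comp A
  have hmat : ∀ g, LinearMap.toMatrixAlgEquiv B (ρ g) = A g := fun g =>
    (LinearMap.toMatrixAlgEquiv B).apply_symm_apply (A g)
  have hrepr : ∀ g v i, B.repr (ρ g v) i = ∑ j, A g i j * B.repr v j := fun g v i => by
    rw [← hmat]
    exact (congrFun (LinearMap.toMatrix_mulVec_repr B B (ρ g) v) i).symm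
  let fil : ℕ → Submodule (ZMod n) (ULift.{u} (Fin d → ZMod n)) := fun i =>
    { carrier := {v | ∀ j : Fin d, i ≤ j → B.repr v j = 0}
      zero_mem' := fun j _ => by simp
      add_mem' := fun {v w} hv hw j hj => by
        rw [map_add, Finsupp.add_apply, hv j hj, hw j hj, add_zero]
      smul_mem' := fun c v hv j hj => by
        rw [map_smul, Finsupp.smul_apply, hv j hj, smul_zero] }
  refine ⟨⟨ULift.{u} (Fin d → ZMod n), ρ, fil, fun i i' hi v hv j hj => hv j (hi.trans hj),
    fun i g v hv j hj => ?_⟩, ⟨B, fun i v => Iff.rfl⟩, MonoidHom.ext hmat⟩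
  rw [hrepr]
  refine Finset.sum_eq_zero fun k _ => ?_
  rcases lt_or_ge k j with h | h
  · rw [hA g j k h, zero_mul]
  · rw [hv k (hj.trans h), mul_zero]

end FiltRep

/-! ## Kummer characters -/

section Kummer

variable {p : ℕ} [Fact p.Prime] {Γ : Type*} [Group Γ] [TopologicalSpace Γ]

theorem isLocallyConstant_toZModPow (r : ℕ) :
    IsLocallyConstant (PadicInt.toZModPow r : ℤ_[p] → ZMod (p ^ r)) := by
  rw [IsLocallyConstant.iff_exists_open]
  intro x
  refine ⟨Metric.ball x ((p : ℝ) ^ (-(r : ℤ))), Metric.isOpen_ball, Metric.mem_ball_self ?_,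
    fun y hy => ?_⟩
  · have := (Fact.out : p.Prime).pos
    positivity
  · rw [Metric.mem_ball, dist_eq_norm] at hy
    have := (PadicInt.norm_le_pow_iff_mem_span_pow _ _).1 hy.le
    rwa [← PadicInt.ker_toZModPow, RingHom.mem_ker, map_sub, sub_eq_zero] at this

theorem isLocallyConstant_charModPow (χ : Γ →ₜ* ℤ_[p]ˣ) (r : ℕ) :
    IsLocallyConstant (charModPow χ r) := by
  have h : IsLocallyConstant fun g => (charModPow χ r g : ZMod (p ^ r)) :=
    (isLocallyConstant_toZModPow r).comp_continuous
      (Units.continuous_val.comp χ.continuous_toFun)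
  exact h.desc _ Units.val Units.val_injective

theorem reductionModP_charModPow (χ : Γ →ₜ* ℤ_[p]ˣ) (r : ℕ) (g : Γ) :
    reductionModP p r (charModPow χ (r + 1) g) = charMod χ g :=
  castHom_toZModPow r.succ_ne_zero _

theorem isLocallyConstant_charMod (χ : Γ →ₜ* ℤ_[p]ˣ) : IsLocallyConstant (charMod χ) := by
  have h : IsLocallyConstant fun g => (charMod χ g : ZMod p) := by
    have := (isLocallyConstant_charModPow χ (0 + 1)).comp fun u => reductionModP p 0 u
    simpa only [Function.comp_def, reductionModP_charModPow] using this
  exact h.desc _ Units.val Units.val_injective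

theorem WH90.exists_cocyclesLift {χ : Γ →ₜ* ℤ_[p]ˣ} (hχ : WH90 χ) {r : ℕ} (hr : 1 ≤ r) :
    ∃ P : Subgroup Γ, IsProPSylow p P ∧ CocyclesLift ((charModPow χ (r + 1)).comp P.subtype) := by
  obtain ⟨P, hP, hsurj⟩ := hχ
  refine ⟨P, hP, fun a ha hamul => ?_⟩
  have htate : ∀ (g : P) x, ((tateMod χ).comp P.subtype) g x = charMod χ g * x := fun g x => by
    simp [tateMod, twist]
  have htate' : ∀ (g : P) x, ((tateModPow χ (r + 1)).comp P.subtype) g x =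
      charModPow χ (r + 1) g * x := fun g x => by
    simp [tateModPow, twist]
  let a' : ContCoh.Z1 ((tateMod χ).comp P.subtype) := ⟨a, ha, fun g h => by
    rw [hamul, htate, ← reductionModP_charModPow χ r]; rfl⟩
  -- Surjectivity on `H¹` lifts the cocycle only up to the coboundary of some `m`; subtracting the
  -- coboundary of a lift `l m` makes the reduction exact.
  obtain ⟨y, hy⟩ := hsurj (r + 1) (by omega) (Submodule.Quotient.mk a')
  obtain ⟨q, rfl⟩ := Submodule.Quotient.mk_surjective _ y
  obtain ⟨m, hm⟩ := (Submodule.Quotient.eq ((LinearMap.range (ContCoh.d0 ((tateMod χ).comp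
    P.subtype))).submoduleOf (ContCoh.Z1 ((tateMod χ).comp P.subtype)))).1 hy
  obtain ⟨l, hl⟩ := exists_reductionModP_section (p := p) (r := r)
  have hm' : ∀ g : P, charMod χ g * m - m = reductionModP p r (q.1 g) - a g := fun g => by
    rw [← htate]
    exact congrFun hm g
  have hχc : IsLocallyConstant fun g : P =>
      (charModPow χ (r + 1) g : ZMod (p ^ (r + 1))) * l m - l m :=
    ((isLocallyConstant_charModPow χ (r + 1)).comp_continuous continuous_subtype_val).comp
      fun u => (u : ZMod (p ^ (r + 1))) * l m - l m
  refine ⟨fun g => q.1 g - (charModPow χ (r + 1) g * l m - l m), q.2.1.sub hχc, fun g h => ?_,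
    fun g => ?_⟩
  · have h1 := q.2.2 g h
    rw [htate'] at h1
    simp only [MonoidHom.comp_apply, Subgroup.coe_subtype, Subgroup.coe_mul, map_mul,
      Units.val_mul]
    linear_combination h1
  · rw [map_sub, map_sub, map_mul, reductionModP_charModPow, hl]
    linear_combination -hm' g

/-- The character `χ^m · τ(μ)` modulo `p^s`, with `τ` the Teichmüller lift. -/
noncomputable def kummerChar (χ : Γ →ₜ* ℤ_[p]ˣ) (s : ℕ) (m : ℤ) (μ : Γ →* (ZMod p)ˣ) :
    Γ →* (ZMod (p ^ s))ˣ :=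
  (zpowGroupHom m).comp (charModPow χ s) * (Units.map (teichmullerMod p s)).comp μ

theorem kummerChar_apply (χ : Γ →ₜ* ℤ_[p]ˣ) (s : ℕ) (m : ℤ) (μ : Γ →* (ZMod p)ˣ) (g : Γ) :
    kummerChar χ s m μ g = charModPow χ s g ^ m * Units.map (teichmullerMod p s) (μ g) := rfl

theorem isLocallyConstant_kummerChar (χ : Γ →ₜ* ℤ_[p]ˣ) (s : ℕ) (m : ℤ) {μ : Γ →* (ZMod p)ˣ}
    (hμ : IsLocallyConstant μ) : IsLocallyConstant (kummerChar χ s m μ) :=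
  ((isLocallyConstant_charModPow χ s).prodMk hμ).comp
    fun y => y.1 ^ m * Units.map (teichmullerMod p s) y.2

theorem twist_teichmullerLift_apply (χ : Γ →ₜ* ℤ_[p]ˣ) (s : ℕ) (m : ℤ) {L : Type*}
    [AddCommGroup L] [Module (ZMod p) L] (ρ : Representation (ZMod p) Γ L) (g : Γ)
    (x : ZMod (p ^ s)) : twist (charModPow χ s) m (teichmullerLift s ρ) g x =
      kummerChar χ s m (lineChar ρ) g * x := by
  rw [kummerChar_apply, Units.val_mul, mul_assoc]
  simp [teichmullerLift, twist]

/-- Reductions of `χ` and truncated Teichmüller lifts are both compatible as the level changes.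
Hence Kummer characters lift with the same `m` and `μ`. -/
theorem castHom_kummerChar (χ : Γ →ₜ* ℤ_[p]ˣ) (r : ℕ) (m : ℤ) (μ : Γ →* (ZMod p)ˣ) (g : Γ) :
    ZMod.castHom (pow_dvd_pow p r.le_succ) (ZMod (p ^ r)) (kummerChar χ (r + 1) m μ g) =
      kummerChar χ r m μ g := by
  let c : ZMod (p ^ (r + 1)) →* ZMod (p ^ r) :=
    (ZMod.castHom (pow_dvd_pow p r.le_succ) (ZMod (p ^ r))).toMonoidHom
  have h1 : Units.map c (charModPow χ (r + 1) g) = charModPow χ r g := Units.ext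
    (RingHom.congr_fun (PadicInt.zmod_cast_comp_toZModPow r (r + 1) r.le_succ) (χ g : ℤ_[p]))
  have h2 : Units.map c (Units.map (teichmullerMod p (r + 1)) (μ g)) =
      Units.map (teichmullerMod p r) (μ g) := Units.ext
    (RingHom.congr_fun (WittVector.toZModPow_compat p r (r + 1) r.le_succ)
      (WittVector.teichmuller p (μ g : ZMod p)))
  have h3 : Units.map c (kummerChar χ (r + 1) m μ g) = kummerChar χ r m μ g := by
    rw [kummerChar_apply, kummerChar_apply, map_mul, map_zpow, h1, h2]
  exact congrArg Units.val h3

theorem reductionModP_kummerChar (χ : Γ →ₜ* ℤ_[p]ˣ) (r : ℕ) (m : ℤ) {μ : Γ →* (ZMod p)ˣ} {g : Γ}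
    (hχ : charMod χ g = 1) (hμ : μ g = 1) :
    reductionModP p r (kummerChar χ (r + 1) m μ g) = 1 := by
  let c : ZMod (p ^ (r + 1)) →* ZMod p := (reductionModP p r).toMonoidHom
  have h1 : Units.map c (charModPow χ (r + 1) g) = 1 :=
    (Units.ext (reductionModP_charModPow χ r g)).trans hχ
  have h3 : Units.map c (kummerChar χ (r + 1) m μ g) = 1 := by
    rw [kummerChar_apply, map_mul, map_zpow, h1, hμ, map_one, map_one, one_zpow, one_mul]
  exact congrArg Units.val h3

end Kummer

/-! ### From flags to matrices and back -/

theorem IsProPSylow.apply_eq_one {p : ℕ} [Fact p.Prime] {Γ : Type*} [Group Γ] [TopologicalSpace Γ]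
    {P : Subgroup Γ} (hP : IsProPSylow p P) {φ : Γ →* (ZMod p)ˣ} (hφ : IsLocallyConstant φ) {x : Γ}
    (hx : x ∈ P) : φ x = 1 :=
  hP.isProP.eq_one_of_isLocallyConstant (φ.comp P.subtype)
    (hφ.comp_continuous continuous_subtype_val) ⟨x, hx⟩

theorem FiltRep.IsCompleteFlag.isLocallyConstant_mat {n d : ℕ} {Γ : Type v} [Group Γ]
    [TopologicalSpace Γ] [IsTopologicalGroup Γ] {F : FiltRep.{u} n Γ} (hF : F.IsCompleteFlag d)
    (b : F.AdaptedBasis d) : IsLocallyConstant b.mat := by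
  obtain ⟨U, -, hU, h⟩ := hF.continuous_action
  refine IsLocallyConstant.of_coset U hU fun g u hu => ?_
  have : b.mat u = 1 := (congrArg (LinearMap.toMatrixAlgEquiv b.basis) (h u hu)).trans (map_one _)
  rw [map_mul, this, mul_one]

theorem FiltRep.IsWoundKummer.nonempty_adaptedBasis {p : ℕ} [Fact p.Prime] {Γ : Type v} [Group Γ]
    [TopologicalSpace Γ] {χ : Γ →ₜ* ℤ_[p]ˣ} {r d : ℕ} (hr : r ≠ 0) {F : FiltRep.{u} (p ^ r) Γ}
    (hF : F.IsWoundKummer χ d) : Nonempty (F.AdaptedBasis d) := by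
  have : Fact (1 < p ^ r) := ⟨Nat.one_lt_pow hr (Fact.out : p.Prime).one_lt⟩
  obtain ⟨N, hN⟩ := hF.kummer
  refine hF.complete.nonempty_adaptedBasis fun k hk => ?_
  obtain ⟨e⟩ := hN (k + 1) (by omega) hk
  exact ⟨e.toLinearEquiv⟩

theorem mainTheorem7 {p : ℕ} [Fact p.Prime] {Γ : Type v} [Group Γ] [TopologicalSpace Γ]
    [IsTopologicalGroup Γ] [CompactSpace Γ] [T2Space Γ] [TotallyDisconnectedSpace Γ]
    (χ : Γ →ₜ* ℤ_[p]ˣ) (hΓ : IsManageable χ) {r d : ℕ} (hr : 1 ≤ r) (hd : 1 ≤ d)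
    (F : FiltRep.{u} (p ^ r) Γ) (hF : F.IsWoundKummer χ d) :
    ∃ F' : FiltRep.{u} (p ^ (r + 1)) Γ, F'.IsWoundKummer χ d ∧ F'.IsLift F := by
  obtain ⟨P₁, hP₁, hχP⟩ := hΓ.wh90.exists_cocyclesLift hr
  obtain ⟨P₂, hP₂, hdem⟩ := hΓ.demuskin
  obtain ⟨b⟩ := hF.nonempty_adaptedBasis (by omega)
  obtain ⟨N, hN⟩ := hF.kummer
  have hlc := hF.complete.isLocallyConstant_mat b
  have hpr : p ∣ p ^ r := dvd_pow_self p (by omega)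
  have hpr' : p ∣ p ^ (r + 1) := dvd_pow_self p r.succ_ne_zero
  have : Fact (1 < p ^ (r + 1)) := ⟨Nat.one_lt_pow r.succ_ne_zero (Fact.out : p.Prime).one_lt⟩
  let cr : ZMod (p ^ (r + 1)) →+* ZMod (p ^ r) :=
    ZMod.castHom (pow_dvd_pow p r.le_succ) (ZMod (p ^ r))
  let c₁ : ZMod (p ^ r) →+* ZMod p := ZMod.castHom hpr (ZMod p)
  have hcc : ∀ x, c₁ (cr x) = reductionModP p r x := fun x =>
    RingHom.congr_fun (RingHom.ext_zmod (c₁.comp cr) (reductionModP p r)) x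
  -- Coordinates start at 0, so index `k` stands for the line `L_{k+1}` and the twist is by `k + 1`.
  let μ : ℕ → Γ →* (ZMod p)ˣ := fun k =>
    lineChar (twist (charMod χ) (k + 1 : ℕ) ((F.reduce p).quoRep k (k + 1)))
  have hμ : ∀ k (hk : k < d) g, (μ k g : ZMod p) =
      ((charMod χ g ^ ((k + 1 : ℕ) : ℤ) : (ZMod p)ˣ) : ZMod p) *
        c₁ (b.mat g ⟨k, hk⟩ ⟨k, hk⟩) := fun k hk g => by
    have h1 := (b.reduce hpr).lineChar_twist_quoRep (charMod χ) (k + 1 : ℕ) ⟨k, hk⟩ g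
    rw [b.mat_reduce] at h1
    exact h1
  have hμc : ∀ k < d, IsLocallyConstant (μ k) := fun k hk => by
    have h : IsLocallyConstant fun g => (μ k g : ZMod p) := by
      simp only [hμ k hk]
      exact ((isLocallyConstant_charMod χ).prodMk hlc).comp fun y =>
        ((y.1 ^ ((k + 1 : ℕ) : ℤ) : (ZMod p)ˣ) : ZMod p) * c₁ (y.2 ⟨k, hk⟩ ⟨k, hk⟩)
    exact h.desc _ Units.val Units.val_injective
  let ψ : ℕ → Γ →* (ZMod (p ^ (r + 1)))ˣ := fun k =>
    kummerChar χ (r + 1) (N - (k + 1 : ℕ)) (μ k)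
  have hψmat : ∀ k (hk : k < d) g, b.mat g ⟨k, hk⟩ ⟨k, hk⟩ = cr (ψ k g) := fun k hk g => by
    rw [castHom_kummerChar]
    exact (b.nonempty_equiv_iff ⟨k, hk⟩ _ _ (fun g x =>
      twist_teichmullerLift_apply χ r (N - (k + 1 : ℕ)) _ g x)).1 (hN (k + 1) (by omega) hk) g
  let σ : ZMod (p ^ r) → ZMod (p ^ (r + 1)) := fun x => (x.val : ZMod (p ^ (r + 1)))
  have hσ : ∀ x, cr (σ x) = x := fun x => by
    simp only [σ, map_natCast, ZMod.natCast_zmod_val]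
  -- An entrywise set-theoretic lift, multiplicative only modulo `p^r`. The value 0 out of range
  -- allows indexing by `ℕ`, which the induction on the rank uses.
  let L : Matrix (Fin d) (Fin d) (ZMod (p ^ r)) → ℕ → ℕ → ZMod (p ^ (r + 1)) := fun X i j =>
    if h : i < d ∧ j < d then σ (X ⟨i, h.1⟩ ⟨j, h.2⟩) else 0
  have hL : ∀ X (i j : Fin d), cr (L X i j) = X i j := fun X i j => by
    simp only [L, i.2, j.2, and_self, dite_true, hσ]
  obtain ⟨A, hA, htri, hdiag, hAL⟩ := exists_triangular_hom_lift (d := d) hP₁ hP₂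
    (charModPow χ (r + 1)) hχP hdem.cupSurjective hr ψ
    (fun k hk => isLocallyConstant_kummerChar _ _ _ (hμc k hk))
    -- On `P₁` the Teichmüller factors vanish, and the exponents of `χ` for `k` and `k + 1` differ
    -- by one.
    (fun k hk x hx => by
      simp only [ψ, kummerChar_apply, hP₁.apply_eq_one (hμc k (by omega)) hx,
        hP₁.apply_eq_one (hμc (k + 1) hk) hx, map_one, mul_one]
      rw [← zpow_one_add]
      congr 1
      push_cast
      ring)
    (fun k hk x hx => reductionModP_kummerChar _ _ _
      (hP₂.apply_eq_one (isLocallyConstant_charMod χ) hx) (hP₂.apply_eq_one (hμc k hk) hx))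
    (fun g => L (b.mat g)) (hlc.comp L)
    (fun g i j hij => by
      by_cases h : i < d ∧ j < d
      · simp [L, h, b.mat_eq_zero g ⟨i, h.1⟩ ⟨j, h.2⟩ hij, σ]
      · simp [L, h])
    (fun g h i j hi hj => by
      rw [← castHom_eq_zero_iff_pow_dvd, ← Fin.sum_univ_eq_sum_range
        (fun k => L (b.mat g) i k * L (b.mat h) k j), map_sub, map_sum, sub_eq_zero]
      have h1 : ∀ k : Fin d, cr (L (b.mat g) i k * L (b.mat h) k j) =
          b.mat g ⟨i, hi⟩ k * b.mat h k ⟨j, hj⟩ := fun k => (map_mul cr _ _).trans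
        (congrArg₂ (· * ·) (hL (b.mat g) ⟨i, hi⟩ k) (hL (b.mat h) k ⟨j, hj⟩))
      exact (hL (b.mat (g * h)) ⟨i, hi⟩ ⟨j, hj⟩).trans (by
        rw [map_mul, Matrix.mul_apply]
        exact Finset.sum_congr rfl fun k _ => (h1 k).symm))
    (fun g i hi => by
      rw [← castHom_eq_zero_iff_pow_dvd, map_sub, sub_eq_zero]
      exact (hL (b.mat g) ⟨i, hi⟩ ⟨i, hi⟩).trans (hψmat i hi g))
    (fun k hk => by
      rintro ⟨m, hm⟩
      refine hF.wound (k + 1) (by omega) hk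
        (((b.reduce hpr).extSplits_iff k hk (Nat.le_succ k)).2 ⟨m, fun g => ?_⟩)
      rw [b.mat_reduce, b.mat_reduce, b.mat_reduce, hψmat, hψmat,
        ← hL (b.mat g) ⟨k, by omega⟩ ⟨k + 1, hk⟩]
      refine (hcc _).trans ((hm g).trans ?_)
      rw [← hcc, ← hcc])
  obtain ⟨F', b', rfl⟩ := FiltRep.exists_adaptedBasis_of_matrix.{u} A htri
  have hcrA : ∀ g i j, cr (b'.mat g i j) = b.mat g i j := fun g i j => by
    have h1 := castHom_eq_zero_iff_pow_dvd.2 (hAL g i j)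
    rw [map_sub, sub_eq_zero] at h1
    exact h1.trans (hL _ i j)
  have hredA : ∀ g i j, (b'.reduce hpr').mat g i j = (b.reduce hpr).mat g i j := fun g i j => by
    rw [b.mat_reduce, b'.mat_reduce, ← hcrA]
    exact (hcc _).symm
  refine ⟨F', ⟨b'.isCompleteFlag hA, ?_, N, ?_⟩, ?_⟩
  -- Woundness depends only on the matrices modulo `p`, which the lift shares with `F`.
  · intro i hi hid hsplit
    obtain ⟨k, rfl⟩ := Nat.exists_eq_add_of_le' hi
    obtain ⟨m, hm⟩ := ((b'.reduce hpr').extSplits_iff k hid (Nat.le_succ k)).1 hsplit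
    refine hF.wound (k + 1) hi hid (((b.reduce hpr).extSplits_iff k hid (Nat.le_succ k)).2
      ⟨m, fun g => ?_⟩)
    rw [← hredA, ← hredA, ← hredA]
    exact hm g
  · intro i hi hid
    obtain ⟨k, rfl⟩ := Nat.exists_eq_add_of_le' hi
    refine (b'.nonempty_equiv_iff ⟨k, hid⟩ _ _ (fun g x =>
      twist_teichmullerLift_apply χ (r + 1) (N - (k + 1 : ℕ)) _ g x)).2 fun g => ?_
    -- The Teichmüller factor required of `F'` is computed from its own reduction modulo `p`, whose
    -- diagonal is that of `F`; hence the prescribed `ψ k` is the right character, with the same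
    -- `N`.
    have hμ' : lineChar (twist (charMod χ) (k + 1 : ℕ) ((F'.reduce p).quoRep k (k + 1))) = μ k := by
      ext g
      rw [hμ k hid]
      have h1 := (b'.reduce hpr').lineChar_twist_quoRep (charMod χ) (k + 1 : ℕ) ⟨k, hid⟩ g
      rw [hredA, b.mat_reduce] at h1
      exact h1
    refine (hdiag g ⟨k, hid⟩).trans ?_
    simp only [ψ, ← hμ']
    rfl
  · exact (b'.reduce (pow_dvd_pow p r.le_succ)).iso b fun g => by
      ext i j
      rw [b'.mat_reduce]
      exact hcrA g i j
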